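/- Let $k$ be an algebraically closed field, $R=k[[X_1,X_2]]$, $K$ its quotient field, and let $v:K\to\mathbf Z\cup\{\infty\}$ be a discrete rank-one valuation, with value group exactly $\mathbf Z$, such that $v\ge 0$ on $R$ and $\{f\in R: v(f)>0\}$ is the maximal ideal of $R$. Let $\hat K$ be the completion of $K$ with respect to $v$, $\hat v$ the extension of $v$ to $\hat K$, and $\Delta_v$ the residue field of $v$. A valuation of a power series ring $k[[Z_1,Z_2]]$ is called monomial if there are positive integers $b_1,b_2$ generating the group $\mathbf Z$ such that the value of every $f=\sum_A f_A Z^A\neq 0$ is $\min\{a_1b_1+a_2b_2 : f_A\ne 0\}$, where $A=(a_1,a_2)$. For a pair $(z_1,z_2)$ of elements of $K$ of positive value, a blowing-up replaces it by $(z_1,z_2/z_1)$ if $v(z_2)>v(z_1)$, and by $(z_1/z_2,z_2)$ if $v(z_1)>v(z_2)$; a coordinate change replaces it by $(z_1,z_2-\alpha z_1)$ if $v(z_1)=v(z_2)$, where $\alpha\in k$ is such that $v(z_2-\alpha z_1)>v(z_1)$. Then either $v$ is monomial or it can be reduced to a monomial valuation by a finite process consisting of blowing-ups and coordinate changes. Precisely,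 there is a pair $(z_1,z_2)$ of elements of $K$ obtained from $(X_1,X_2)$ by a finite (possibly empty) sequence of blowing-ups and coordinate changes, by blowing-ups alone if $v$ is monomial, such that: 1. $v(z_1)=v(z_2)=1$; every $f\in k[[Z_1,Z_2]]$ has a convergent value $f(z_1,z_2)\in\hat K$, and $f\mapsto f(z_1,z_2)$ is an injective ring homomorphism, whose image, denoted $k[[z_1,z_2]]$, contains $k[[X_1,X_2]]$ (the inclusion being given by a $k$-algebra homomorphism $\psi:k[[X_1,X_2]]\to k[[z_1,z_2]]$). 2. The restriction of $\hat v$ to $k[[z_1,z_2]]$ is the monomial valuation with weights $(1,1)$. 3. The residue $u$ of $z_2/z_1$ in $\Delta_v$ is transcendental over $k$, and $\Delta_v=k(u)$. 4. The $k$-algebra homomorphism $\varphi:k[[z_1,z_2]]\to k(u)[[t]]$, $f(z_1,z_2)\mapsto f(t,ut)$, is injective; the restriction of $\hat v$ to $k[[z_1,z_2]]$ is the composition of $\varphi$ with the $t$-order function, and $v$ on $k[[X_1,X_2]]$ is the composition of $\varphi\circ\psi$ with the $t$-order function. -/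

import Mathlib

open scoped WithZero

noncomputable section

namespace PowerSeriesValuation

/-- The ring `R = k[[X₁, X₂]]`. -/
abbrev Ring₂ (k : Type*) [Field k] : Type _ := MvPowerSeries (Fin 2) k

/-- The field `K = k((X₁, X₂))`, the quotient field of `k[[X₁, X₂]]`. -/
abbrev Field₂ (k : Type*) [Field k] : Type _ := FractionRing (Ring₂ k)

/-- The multiplicative form in `ℤᵐ⁰` of an additive value `n ∈ ℕ ∪ {∞}`:
`n ↦ exp (-n)` and `∞ ↦ 0`. -/
def ofOrder (n : ℕ∞) : ℤᵐ⁰ :=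
  if n = ⊤ then 0 else WithZero.exp (-(n.toNat : ℤ))

/-- `val` is the monomial valuation of rank one attached to the weights `B`: the weights are
positive, they generate the group `ℤ`, and the (additive) value of a power series `f` is the
minimum of the weighted degrees `∑ i, A i * B i` over the exponents `A` occurring in `f`. -/
structure IsMonomialWith {σ k : Type*} [Field k] (val : MvPowerSeries σ k → ℤᵐ⁰) (B : σ → ℕ) :
    Prop where
  pos : ∀ i, 0 < B i
  generates : AddSubgroup.closure (Set.range fun i => (B i : ℤ)) = ⊤
  eq : ∀ f, val f = ofOrder (f.weightedOrder B)

/-- `val` is the monomial valuation attached to some system of weights. -/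
def IsMonomial {σ k : Type*} [Field k] (val : MvPowerSeries σ k → ℤᵐ⁰) : Prop :=
  ∃ B : σ → ℕ, IsMonomialWith val B

/-- The valuation ring of `v` contains `k[[X₁, X₂]]`, and the center of `v` in it is the
maximal ideal. -/
class IsCentered {k : Type*} [Field k] (v : Valuation (Field₂ k) ℤᵐ⁰) : Prop where
  le_one : ∀ f : Ring₂ k, v (algebraMap (Ring₂ k) (Field₂ k) f) ≤ 1
  lt_one_iff : ∀ f : Ring₂ k, v (algebraMap (Ring₂ k) (Field₂ k) f) < 1 ↔
    f ∈ IsLocalRing.maximalIdeal (Ring₂ k)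

section

variable {k : Type*} [Field k] (v : Valuation (Field₂ k) ℤᵐ⁰)

/-- The valuation ring of a centered valuation is a `k`-algebra; hence so is its residue field. -/
instance [IsCentered v] : Algebra k v.valuationSubring :=
  RingHom.toAlgebra <|
    (algebraMap k (Field₂ k)).codRestrict v.valuationSubring.toSubring fun c => by
      have h := IsCentered.le_one (v := v) (algebraMap k (Ring₂ k) c)
      rwa [← IsScalarTower.algebraMap_apply k (Ring₂ k) (Field₂ k)] at h

/-- The residue field `Δ_v`. -/
abbrev Residue : Type _ := IsLocalRing.ResidueField v.valuationSubring

/-- The embedding of `K` into its completion with respect to `v`. -/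
def toCompletion : Field₂ k →+* v.Completion :=
  (UniformSpace.Completion.coeRingHom (α := WithVal v)).comp
    (WithVal.equiv v).symm.toRingHom

/-- The extension `v̂` of `v` to the completion. -/
def completedValuation : Valuation v.Completion ℤᵐ⁰ := Valued.v

/-- The variables `(X₁, X₂)`, as elements of `K`. -/
def coords (k : Type*) [Field k] : Fin 2 → Field₂ k :=
  fun i => algebraMap (Ring₂ k) (Field₂ k) (MvPowerSeries.X i)

/-- One blowing-up: the component of larger (additive) value is divided by the other one, which
has positive value. -/
inductive BlowUp : (Fin 2 → Field₂ k) → (Fin 2 → Field₂ k) → Prop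
  | second (z₁ z₂ : Field₂ k) : v z₁ < 1 → v z₂ < v z₁ → BlowUp ![z₁, z₂] ![z₁, z₂ / z₁]
  | first (z₁ z₂ : Field₂ k) : v z₂ < 1 → v z₁ < v z₂ → BlowUp ![z₁, z₂] ![z₁ / z₂, z₂]

/-- One coordinate change over `k`: if the components have the same positive value and the residue
of `z₂ / z₁` is `α ∈ k`, i.e. `z₂ - α z₁` has larger value, then `z₂` is replaced by
`z₂ - α z₁`. -/
inductive CoordChange : (Fin 2 → Field₂ k) → (Fin 2 → Field₂ k) → Prop
  | mk (z₁ z₂ : Field₂ k) (α : k) : v z₁ < 1 → v z₂ = v z₁ →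
      v (z₂ - algebraMap k (Field₂ k) α * z₁) < v z₁ →
      CoordChange ![z₁, z₂] ![z₁, z₂ - algebraMap k (Field₂ k) α * z₁]

/-- One step of the reduction process. -/
def Step (z z' : Fin 2 → Field₂ k) : Prop := BlowUp v z z' ∨ CoordChange v z z'

/-- The ring homomorphism `ε` from `k[[Z₁, Z₂]]` to the completion is the evaluation at
`z = (z₁, z₂)`: `ε f` is the sum of the convergent series `f(z₁, z₂)`. -/
def IsEvaluation (z : Fin 2 → Field₂ k) (ε : MvPowerSeries (Fin 2) k →+* v.Completion) : Prop :=
  ∀ f : MvPowerSeries (Fin 2) k,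
    HasSum (fun A : Fin 2 →₀ ℕ => toCompletion v
      (algebraMap k (Field₂ k) (MvPowerSeries.coeff A f) * ∏ i, z i ^ A i)) (ε f)

end

/-- The `k`-algebra homomorphism `k[[Z₁, Z₂]] → F[[t]]`, `f ↦ f(t, u t)`. -/
def lineSubst (k : Type*) [Field k] {F : Type*} [Field F] [Algebra k F] (u : F) :
    MvPowerSeries (Fin 2) k →ₐ[k] PowerSeries F :=
  MvPowerSeries.substAlgHom
    (a := ![(PowerSeries.X : PowerSeries F), PowerSeries.C u * PowerSeries.X])
    (MvPowerSeries.hasSubst_of_constantCoeff_zero (by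
      intro s
      change PowerSeries.constantCoeff _ = 0
      fin_cases s <;> simp))

end PowerSeriesValuation

end

/-!
The Euclidean algorithm on the values of the two components is a sequence of blowing-ups leading
to a pair `(z₁, z₂)` whose components have the same value. If the residue of `z₂ / z₁` lies in `k`,
a coordinate change raises the value of the second component and the algorithm is run again. The
process stops at a terminal pair (`IsTerminal`), and then the residue `u` of `z₂ / z₁` is
transcendental over the algebraically closed field `k`.

Termination (`exists_isTerminal`): the smaller value never increases, so an infinite process
eventually fixes the first component `x`, and the successive divisions by `x` write the second
component as a power series in `x` (`exists_seriesEval_eq_of_digits`). Every step keeps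
`k[[X₁, X₂]]` inside `k[[z₁, z₂]]` (`Dominates`), so `k[[X₁, X₂]]` would embed into a power series
ring in one variable; this is impossible, because `k[[t]]` is integral over the power series in any
nonzero series without constant term (`not_injective_mvPowerSeries_to_powerSeries`).

If `v` is monomial, the first pair with equal values is already terminal: `z₂ / z₁` is a nonconstant
Laurent monomial in `X₁, X₂` of value zero, and two monomials of the same value do not cancel
(`exists_isTerminal_of_isMonomial`).

At a terminal pair with components of value `a`, a homogeneous form of degree `n` takes the value
`z₁ⁿ P(z₂ / z₁)` with `P ≠ 0` and hence `P(u) ≠ 0`, so that `f(z₁, z₂)` has value `a` times the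
order of `f` (`valued_seriesEval_eq`). Surjectivity of `v` forces `a = 1`; quotients of leading
forms show that the residue field is `k(u)` (`adjoin_residue_eq_top`); and the coefficients of
`f(t, u t)` are the elements `P(u)`, which identifies the `t`-order with the order of `f`
(`order_lineSubst`).
-/

open scoped WithZero

namespace PowerSeriesValuation

open Filter Topology

/-! ### Evaluation of power series in a complete valued field -/

section Evaluation

variable {k L σ : Type*} [Field k] [Field L] [Valued L ℤᵐ⁰]

theorem exists_exp_neg_le {r : ℤᵐ⁰} (hr : r ≠ 0) : ∃ n : ℕ, WithZero.exp (-(n : ℤ)) ≤ r := by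
  refine ⟨(-WithZero.log r).toNat, ?_⟩
  rw [← WithZero.exp_log hr, WithZero.exp_le_exp, WithZero.log_exp]
  omega

theorem eq_zero_of_le_exp_neg {r : ℤᵐ⁰} (h : ∀ n : ℕ, r ≤ WithZero.exp (-(n : ℤ))) : r = 0 := by
  by_contra hr
  obtain ⟨n, hn⟩ := exists_exp_neg_le hr
  have := hn.trans (h (n + 1))
  rw [WithZero.exp_le_exp] at this
  omega

theorem lt_one_iff_le_exp_neg_one {r : ℤᵐ⁰} : r < 1 ↔ r ≤ WithZero.exp (-1) := by
  rcases eq_or_ne r 0 with rfl | hr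
  · simp
  · rw [← WithZero.exp_log hr, ← WithZero.exp_zero, WithZero.exp_lt_exp, WithZero.exp_le_exp]
    omega

theorem exists_exp_neg_le_mem_of_mem_nhds {s : Set L} (hs : s ∈ 𝓝 (0 : L)) :
    ∃ n : ℕ, ∀ x : L, Valued.v x ≤ WithZero.exp (-(n : ℤ)) → x ∈ s := by
  obtain ⟨γ, hγ⟩ := Valued.mem_nhds_zero.mp hs
  obtain ⟨n, hn⟩ := exists_exp_neg_le
    (r := MonoidWithZeroHom.ValueGroup₀.embedding γ.1) (by simp)
  refine ⟨n + 1, fun x hx => hγ ?_⟩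
  refine (Valuation.restrict_lt_iff_lt_embedding _).mpr (hx.trans_lt (lt_of_lt_of_le ?_ hn))
  rw [WithZero.exp_lt_exp]
  push_cast
  omega

theorem isClosed_valuation_le (r : ℤᵐ⁰) : IsClosed {x : L | Valued.v x ≤ r} := by
  rw [← isOpen_compl_iff, isOpen_iff_mem_nhds]
  intro x hx
  have hx' : r < Valued.v x := not_le.mp hx
  refine Filter.mem_of_superset (Valued.locally_const hx'.ne_zero) fun y hy => ?_
  have hy' : Valued.v y = Valued.v x := hy
  simpa [hy'] using hx'

theorem nonarchimedeanRing_of_valued : NonarchimedeanRing L where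
  is_nonarchimedean U hU := by
    obtain ⟨γ, hγ⟩ := Valued.mem_nhds_zero.mp hU
    exact ⟨⟨Valuation.ltAddSubgroup (Valued.v (R := L)).restrict γ, Valued.isOpen_ball _ _⟩, hγ⟩

variable [Fintype σ]

/-- The term of exponent `A` of the series `f(z)`, the coefficients being mapped by `κ`. -/
noncomputable def seriesTerm (κ : k →+* L) (z : σ → L) (f : MvPowerSeries σ k) (A : σ →₀ ℕ) : L :=
  κ (MvPowerSeries.coeff A f) * ∏ i, z i ^ A i

theorem valuation_prod_pow_le {z : σ → L} {b : ℕ}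
    (hz : ∀ i, Valued.v (z i) ≤ WithZero.exp (-(b : ℤ))) (A : σ →₀ ℕ) :
    Valued.v (∏ i, z i ^ A i) ≤ WithZero.exp (-((b * A.degree : ℕ) : ℤ)) := by
  rw [map_prod, Finsupp.degree_eq_sum]
  calc ∏ i, Valued.v (z i ^ A i) ≤ ∏ i, WithZero.exp (-(b : ℤ)) ^ A i := by
        refine Finset.prod_le_prod' fun i _ => ?_
        rw [map_pow]
        exact pow_le_pow_left₀ zero_le (hz i) _
    _ = _ := by
        rw [Finset.prod_pow_eq_pow_sum, ← WithZero.exp_nsmul]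
        congr 1
        push_cast
        rw [nsmul_eq_mul]
        push_cast
        ring

variable {κ : k →+* L} {z : σ → L}

theorem valuation_seriesTerm_le (hκ : ∀ c, Valued.v (κ c) ≤ 1) {b : ℕ}
    (hz : ∀ i, Valued.v (z i) ≤ WithZero.exp (-(b : ℤ))) (f : MvPowerSeries σ k) (A : σ →₀ ℕ) :
    Valued.v (seriesTerm κ z f A) ≤ WithZero.exp (-((b * A.degree : ℕ) : ℤ)) := by
  rw [seriesTerm, map_mul]
  exact mul_le_of_le_one_of_le (hκ _) (valuation_prod_pow_le hz A)

theorem summable_seriesTerm [CompleteSpace L] (hκ : ∀ c, Valued.v (κ c) ≤ 1)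
    (hz : ∀ i, Valued.v (z i) < 1) (f : MvPowerSeries σ k) : Summable (seriesTerm κ z f) := by
  have := nonarchimedeanRing_of_valued (L := L)
  refine NonarchimedeanAddGroup.summable_of_tendsto_cofinite_zero ?_
  intro s hs
  obtain ⟨n, hn⟩ := exists_exp_neg_le_mem_of_mem_nhds hs
  rw [mem_map, mem_cofinite]
  refine (Finsupp.finite_of_degree_le n).subset fun A hA => ?_
  by_contra hA'
  refine hA (hn _ ((valuation_seriesTerm_le hκ (b := 1)
    (fun i => by simpa using lt_one_iff_le_exp_neg_one.mp (hz i)) f A).trans ?_))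
  rw [WithZero.exp_le_exp]
  have : n < A.degree := not_le.mp hA'
  omega

/-- Evaluation of power series at a tuple `z` of elements of positive (additive) value of a complete
valued field, the coefficients being mapped by `κ`. -/
noncomputable def evalHom [CompleteSpace L] (hκ : ∀ c, Valued.v (κ c) ≤ 1)
    (hz : ∀ i, Valued.v (z i) < 1) : MvPowerSeries σ k →+* L where
  toFun f := ∑' A, seriesTerm κ z f A
  map_zero' := by simp [seriesTerm]
  map_one' := by
    classical
    rw [tsum_eq_single 0]
    · simp [seriesTerm]
    · intro A hA
      simp [seriesTerm, MvPowerSeries.coeff_one, hA]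
  map_add' f g := by
    rw [← (summable_seriesTerm hκ hz f).tsum_add (summable_seriesTerm hκ hz g)]
    exact tsum_congr fun A => by simp [seriesTerm, add_mul]
  map_mul' f g := by
    classical
    have := nonarchimedeanRing_of_valued (L := L)
    have hf := summable_seriesTerm hκ hz f
    have hg := summable_seriesTerm hκ hz g
    rw [hf.tsum_mul_tsum_eq_tsum_sum_antidiagonal hg (hf.mul_of_nonarchimedean hg)]
    refine tsum_congr fun A => ?_
    rw [seriesTerm, MvPowerSeries.coeff_mul, map_sum, Finset.sum_mul]
    refine Finset.sum_congr rfl fun p hp => ?_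
    rw [← Finset.HasAntidiagonal.mem_antidiagonal.mp hp]
    simp only [seriesTerm, map_mul, Finsupp.add_apply, pow_add, Finset.prod_mul_distrib]
    ring

section

variable [CompleteSpace L] (hκ : ∀ c, Valued.v (κ c) ≤ 1) (hz : ∀ i, Valued.v (z i) < 1)

theorem hasSum_evalHom (f : MvPowerSeries σ k) : HasSum (seriesTerm κ z f) (evalHom hκ hz f) :=
  (summable_seriesTerm hκ hz f).hasSum

theorem valuation_evalHom_le {r : ℤᵐ⁰} {f : MvPowerSeries σ k}
    (h : ∀ A, Valued.v (seriesTerm κ z f A) ≤ r) : Valued.v (evalHom hκ hz f) ≤ r :=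
  (isClosed_valuation_le r).mem_of_tendsto (hasSum_evalHom hκ hz f)
    (Eventually.of_forall fun _ => Valuation.map_sum_le _ fun A _ => h A)

theorem valuation_evalHom_le_one (f : MvPowerSeries σ k) : Valued.v (evalHom hκ hz f) ≤ 1 :=
  valuation_evalHom_le hκ hz fun A => by
    simpa using valuation_seriesTerm_le hκ (b := 0) (fun i => by simpa using (hz i).le) f A

theorem evalHom_C (c : k) : evalHom hκ hz (MvPowerSeries.C c) = κ c := by
  classical
  refine (tsum_eq_single 0 fun A hA => ?_).trans ?_
  · simp [seriesTerm, MvPowerSeries.coeff_C, hA]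
  · simp [seriesTerm]

theorem evalHom_X (i : σ) : evalHom hκ hz (MvPowerSeries.X i) = z i := by
  classical
  refine (tsum_eq_single (Finsupp.single i 1) fun A hA => ?_).trans ?_
  · simp [seriesTerm, MvPowerSeries.coeff_X, hA]
  · simp [seriesTerm, MvPowerSeries.coeff_X, Finsupp.single_apply]

end

end Evaluation

/-! ### Uniqueness of local homomorphisms -/

section Uniqueness

variable {k : Type*} [Field k]

/-- Removal of the constant term and division by the variables: the monomials involving `X 0` are
divided by `X 0`, the remaining ones by `X 1`. -/
theorem exists_eq_C_add_X_mul (f : MvPowerSeries (Fin 2) k) :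
    ∃ (c : k) (g₀ g₁ : MvPowerSeries (Fin 2) k),
      f = MvPowerSeries.C c + MvPowerSeries.X 0 * g₀ + MvPowerSeries.X 1 * g₁ := by
  let h : MvPowerSeries (Fin 2) k := fun A =>
    if A 0 = 0 ∧ A 1 ≠ 0 then MvPowerSeries.coeff A f else 0
  have hh : ∀ A, MvPowerSeries.coeff A h =
      if A 0 = 0 ∧ A 1 ≠ 0 then MvPowerSeries.coeff A f else 0 := fun A => rfl
  obtain ⟨g₁, hg₁⟩ : MvPowerSeries.X 1 ∣ h :=
    MvPowerSeries.X_dvd_iff.mpr fun A hA => by simp [hh, hA]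
  obtain ⟨g₀, hg₀⟩ : MvPowerSeries.X 0 ∣
      f - MvPowerSeries.C (MvPowerSeries.constantCoeff f) - h := by
    refine MvPowerSeries.X_dvd_iff.mpr fun A hA => ?_
    classical
    rw [map_sub, map_sub, hh, MvPowerSeries.coeff_C]
    by_cases h1 : A 1 = 0
    · have : A = 0 := by
        ext i
        fin_cases i <;> simp [hA, h1]
      simp [this]
    · have : A ≠ 0 := fun h0 => h1 (by simp [h0])
      simp [hA, h1, this]
  exact ⟨MvPowerSeries.constantCoeff f, g₀, g₁, by rw [← hg₀, ← hg₁]; ring⟩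

/-- A local homomorphism from `k[[X₁, X₂]]` to a discretely valued field is determined by its values
on the constants and the variables: writing `f = c + X₁ g₀ + X₂ g₁` shows that the difference of two
such homomorphisms takes values divisible by every power of the uniformizer. -/
theorem ringHom_ext_of_valuation_le_one {L : Type*} [Field L] {w : Valuation L ℤᵐ⁰}
    {g h : MvPowerSeries (Fin 2) k →+* L} (hg : ∀ f, w (g f) ≤ 1) (hh : ∀ f, w (h f) ≤ 1)
    (hC : ∀ c, g (MvPowerSeries.C c) = h (MvPowerSeries.C c))
    (hX : ∀ i, g (MvPowerSeries.X i) = h (MvPowerSeries.X i))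
    (hlt : ∀ i, w (h (MvPowerSeries.X i)) < 1) : g = h := by
  have key : ∀ n : ℕ, ∀ f, w (g f - h f) ≤ WithZero.exp (-(n : ℤ)) := by
    intro n
    induction n with
    | zero => exact fun f => by simpa using (w.map_sub _ _).trans (max_le (hg f) (hh f))
    | succ n ih =>
      intro f
      obtain ⟨c, g₀, g₁, rfl⟩ := exists_eq_C_add_X_mul f
      have : g (MvPowerSeries.C c + MvPowerSeries.X 0 * g₀ + MvPowerSeries.X 1 * g₁) -
          h (MvPowerSeries.C c + MvPowerSeries.X 0 * g₀ + MvPowerSeries.X 1 * g₁) =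
          h (MvPowerSeries.X 0) * (g g₀ - h g₀) + h (MvPowerSeries.X 1) * (g g₁ - h g₁) := by
        simp only [map_add, map_mul, hC, hX]
        ring
      rw [this]
      have step : ∀ i f', w (h (MvPowerSeries.X i) * (g f' - h f')) ≤
          WithZero.exp (-((n + 1 : ℕ) : ℤ)) := fun i f' => by
        rw [map_mul]
        refine (mul_le_mul' (lt_one_iff_le_exp_neg_one.mp (hlt i)) (ih f')).trans_eq ?_
        rw [← WithZero.exp_add]
        congr 1
        push_cast
        ring
      exact (w.map_add _ _).trans (max_le (step 0 g₀) (step 1 g₁))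
  ext f
  exact sub_eq_zero.mp ((map_eq_zero w).mp (eq_zero_of_le_exp_neg fun n => key n f))

end Uniqueness

/-! ### Power series rings in one and two variables -/

section Dimension

variable {k : Type*} [Field k]

theorem isIntegral_of_forall_exists_sum {A B : Type*} [CommRing A] [CommRing B] (j : A →+* B)
    [DecidableEq B] {d : ℕ} (e : Fin d → B) (h : ∀ g, ∃ a : Fin d → A, g = ∑ i, j (a i) * e i) :
    j.IsIntegral := by
  algebraize [j]
  refine RingHom.Finite.to_isIntegral ?_
  change Module.Finite A B
  refine ⟨⟨Finset.univ.image e, ?_⟩⟩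
  rw [Finset.coe_image, Finset.coe_univ, Set.image_univ, eq_top_iff]
  intro g _
  obtain ⟨a, rfl⟩ := h g
  exact Submodule.sum_mem _ fun i _ => Submodule.smul_mem _ (a i)
    (Submodule.subset_span (Set.mem_range_self i))

/-- The ring `k[[t]]` is integral over the subring of power series in a nonzero series `f` without
constant term, say of order `d`: the powers `1, t, …, t^(d-1)` generate, since repeated division
by `f`, with remainders of degree less than `d`, produces the digits of the coefficients. -/
theorem isIntegral_of_map_X (j : PowerSeries k →+* PowerSeries k)
    (hC : ∀ c, j (PowerSeries.C c) = PowerSeries.C c) (h0 : j PowerSeries.X ≠ 0)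
    (h1 : PowerSeries.constantCoeff (j PowerSeries.X) = 0) : j.IsIntegral := by
  set f := j PowerSeries.X with hf
  set d := f.order.toNat
  -- one step of the division by `f`
  have step : ∀ g : PowerSeries k, ∃ (c : Fin d → k) (g' : PowerSeries k),
      g = ∑ i, PowerSeries.C (c i) * PowerSeries.X ^ (i : ℕ) + f * g' := by
    intro g
    obtain ⟨u, hu⟩ : ∃ u : PowerSeries k, PowerSeries.X ^ d = f * u := by
      obtain ⟨w, hw⟩ := PowerSeries.isUnit_divided_by_X_pow_order h0
      refine ⟨↑w⁻¹, ?_⟩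
      rw [Units.eq_mul_inv_iff_mul_eq, hw]
      exact PowerSeries.X_pow_order_mul_divXPowOrder
    obtain ⟨q, hq⟩ : PowerSeries.X ^ d ∣
        g - ∑ i : Fin d, PowerSeries.C (PowerSeries.coeff i g) * PowerSeries.X ^ (i : ℕ) := by
      rw [PowerSeries.X_pow_dvd_iff]
      intro m hm
      rw [map_sub, map_sum, Finset.sum_eq_single ⟨m, hm⟩]
      · simp
      · intro i _ hi
        rw [PowerSeries.coeff_C_mul_X_pow, if_neg fun h => hi (Fin.ext h.symm)]
      · simp
    refine ⟨fun i => PowerSeries.coeff i g, u * q, ?_⟩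
    rw [← mul_assoc, ← hu, ← hq]
    ring
  choose c S hS using step
  -- the coefficients of the expansion
  let a : PowerSeries k → Fin d → PowerSeries k := fun g i =>
    PowerSeries.mk fun n => c (S^[n] g) i
  have ha : ∀ g i, a g i = PowerSeries.C (c g i) + PowerSeries.X * a (S g) i := by
    intro g i
    ext n
    cases n with
    | zero => simp [a]
    | succ n => simp [a, PowerSeries.coeff_succ_X_mul]
  let T : PowerSeries k → PowerSeries k := fun g => ∑ i, j (a g i) * PowerSeries.X ^ (i : ℕ)
  have hT : ∀ g, g - T g = f * (S g - T (S g)) := by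
    intro g
    have : T g = ∑ i, PowerSeries.C (c g i) * PowerSeries.X ^ (i : ℕ) + f * T (S g) := by
      simp only [T]
      rw [Finset.mul_sum, ← Finset.sum_add_distrib]
      refine Finset.sum_congr rfl fun i _ => ?_
      rw [ha g i, map_add, map_mul, hC, ← hf]
      ring
    rw [this]
    nth_rw 1 [hS g]
    ring
  have hdvd : ∀ n : ℕ, ∀ g, PowerSeries.X ^ n ∣ g - T g := by
    intro n
    induction n with
    | zero => simp
    | succ n ih =>
      intro g
      rw [hT, pow_succ']
      exact mul_dvd_mul (PowerSeries.X_dvd_iff.mpr h1) (ih _)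
  have hg : ∀ g, g = T g := by
    intro g
    refine sub_eq_zero.mp (PowerSeries.ext fun n => ?_)
    rw [PowerSeries.X_pow_dvd_iff.mp (hdvd (n + 1) g) n n.lt_succ_self, map_zero]
  classical
  exact isIntegral_of_forall_exists_sum j (fun i : Fin d => PowerSeries.X ^ (i : ℕ))
    fun g => ⟨a g, hg g⟩

/-- There is no injective homomorphism `k[[X₁, X₂]] → k[[t]]` of `k`-algebras: `k[[t]]` being
integral over `k[[X₁]]`, the image of `X₂` would satisfy a monic equation with coefficients in
`k[[X₁]]`, so that `X₂` would satisfy it. -/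
theorem not_injective_mvPowerSeries_to_powerSeries
    (θ : MvPowerSeries (Fin 2) k →ₐ[k] PowerSeries k) : ¬ Function.Injective θ := by
  intro hθ
  -- the embedding of `k[[X₁]]`
  let i : PowerSeries k →ₐ[k] MvPowerSeries (Fin 2) k :=
    PowerSeries.substAlgHom (PowerSeries.HasSubst.X (0 : Fin 2))
  have hiX : i PowerSeries.X = MvPowerSeries.X 0 := PowerSeries.substAlgHom_X _
  have hC : ∀ c, θ (i (PowerSeries.C c)) = PowerSeries.C c := fun c =>
    (θ.comp i).commutes c
  have hX0 : PowerSeries.constantCoeff (θ (i PowerSeries.X)) = 0 := by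
    by_contra hc
    set c := PowerSeries.constantCoeff (θ (i PowerSeries.X)) with hcd
    have hu : IsUnit (MvPowerSeries.X 0 - MvPowerSeries.C c : MvPowerSeries (Fin 2) k) := by
      rw [MvPowerSeries.isUnit_iff_constantCoeff]
      simpa using hc
    have hu' := hu.map θ
    rw [map_sub, ← hiX, show θ (MvPowerSeries.C c) = PowerSeries.C c from θ.commutes c,
      PowerSeries.isUnit_iff_constantCoeff, map_sub, ← hcd] at hu'
    simp at hu'
  have hX1 : θ (i PowerSeries.X) ≠ 0 := by
    rw [map_ne_zero_iff θ hθ, hiX]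
    intro h
    have := congrArg (MvPowerSeries.coeff (Finsupp.single 0 1)) h
    simp at this
  obtain ⟨P, hP, hP0⟩ := isIntegral_of_map_X (θ.comp i).toRingHom hC hX1 hX0
    (θ (MvPowerSeries.X 1))
  have hP1 : P.eval₂ (i : PowerSeries k →+* MvPowerSeries (Fin 2) k) (MvPowerSeries.X 1) = 0 := by
    apply hθ
    rw [map_zero, ← hP0]
    exact Polynomial.hom_eval₂ P i.toRingHom θ.toRingHom _
  -- setting `X₁ = 0` leaves a monic polynomial in `X₂` over `k`
  let π : MvPowerSeries (Fin 2) k →ₐ[k] PowerSeries k := MvPowerSeries.substAlgHom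
    (a := ![0, PowerSeries.X]) (MvPowerSeries.hasSubst_of_constantCoeff_zero (by
      intro s
      change PowerSeries.constantCoeff _ = 0
      fin_cases s <;> simp))
  have hπ0 : π (MvPowerSeries.X 0) = 0 := MvPowerSeries.substAlgHom_X _ _
  have hπ1 : π (MvPowerSeries.X 1) = PowerSeries.X := MvPowerSeries.substAlgHom_X _ _
  have hπi : ∀ a, π (i a) = PowerSeries.C (PowerSeries.constantCoeff a) := by
    intro a
    obtain ⟨b, hb⟩ : PowerSeries.X ∣ a - PowerSeries.C (PowerSeries.constantCoeff a) := by
      rw [PowerSeries.X_dvd_iff]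
      simp
    rw [sub_eq_iff_eq_add] at hb
    nth_rw 1 [hb]
    rw [map_add, map_add, map_mul, map_mul, hiX, hπ0, zero_mul, zero_add]
    exact (π.comp i).commutes _
  have hP2 : (P.map PowerSeries.constantCoeff : Polynomial k).eval₂ PowerSeries.C
      (PowerSeries.X : PowerSeries k) = 0 := by
    rw [Polynomial.eval₂_map, ← map_zero π, ← hP1]
    refine Eq.trans ?_ (Polynomial.hom_eval₂ P i.toRingHom π.toRingHom _).symm
    congr 1
    · ext a : 1
      exact (hπi a).symm
    · exact hπ1.symm
  rw [← Polynomial.coe_zero, Polynomial.eval₂_C_X_eq_coe, Polynomial.coe_inj] at hP2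
  exact (hP.map _).ne_zero hP2

end Dimension

/-! ### Pairs of elements dominating the power series ring -/

section Centered

variable {k : Type*} [Field k] (v : Valuation (Field₂ k) ℤᵐ⁰)

theorem valued_toCompletion (x : Field₂ k) : Valued.v (toCompletion v x) = v x :=
  Valued.valuedCompletion_apply (K := WithVal v) _

theorem toCompletion_algebraMap_injective :
    Function.Injective fun f : Ring₂ k => toCompletion v (algebraMap (Ring₂ k) (Field₂ k) f) :=
  (toCompletion v).injective.comp (IsFractionRing.injective (Ring₂ k) (Field₂ k))

theorem valuation_coords_ne_zero (i : Fin 2) : v (coords k i) ≠ 0 := by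
  rw [map_ne_zero, coords, map_ne_zero_iff _ (IsFractionRing.injective (Ring₂ k) (Field₂ k))]
  intro h
  have := congrArg (MvPowerSeries.coeff (Finsupp.single i 1)) h
  simp at this

variable [IsCentered v]

theorem valuation_algebraMap_le_one (c : k) : v (algebraMap k (Field₂ k) c) ≤ 1 := by
  have h := IsCentered.le_one (v := v) (algebraMap k (Ring₂ k) c)
  rwa [← IsScalarTower.algebraMap_apply k (Ring₂ k) (Field₂ k)] at h

theorem valued_constants_le_one (c : k) :
    Valued.v ((toCompletion v).comp (algebraMap k (Field₂ k)) c) ≤ 1 := by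
  rw [RingHom.comp_apply, valued_toCompletion]
  exact valuation_algebraMap_le_one v c

variable {σ : Type*} [Fintype σ] {z : σ → Field₂ k}

/-- The evaluation homomorphism `f ↦ f(z)` into the completion, for a tuple `z` of elements of `K`
of positive value. -/
noncomputable def seriesEval (hz : ∀ i, v (z i) < 1) : MvPowerSeries σ k →+* v.Completion :=
  evalHom (z := fun i => toCompletion v (z i)) (valued_constants_le_one v)
    fun i => (valued_toCompletion v (z i)).trans_lt (hz i)

theorem seriesEval_C (hz : ∀ i, v (z i) < 1) (c : k) :
    seriesEval v hz (MvPowerSeries.C c) = toCompletion v (algebraMap k (Field₂ k) c) :=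
  evalHom_C _ _ c

theorem seriesEval_X (hz : ∀ i, v (z i) < 1) (i : σ) :
    seriesEval v hz (MvPowerSeries.X i) = toCompletion v (z i) :=
  evalHom_X _ _ i

theorem valued_seriesEval_le_one (hz : ∀ i, v (z i) < 1) (f : MvPowerSeries σ k) :
    Valued.v (seriesEval v hz f) ≤ 1 :=
  valuation_evalHom_le_one _ _ f

theorem constantCoeff_eq_zero_of_seriesEval_lt_one (hz : ∀ i, v (z i) < 1) {f : MvPowerSeries σ k}
    (hf : Valued.v (seriesEval v hz f) < 1) : MvPowerSeries.constantCoeff f = 0 := by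
  by_contra h
  obtain ⟨g, hg⟩ := (MvPowerSeries.isUnit_iff_constantCoeff.mpr (Ne.isUnit h)).exists_right_inv
  have h1 := congrArg (fun f => Valued.v (seriesEval v hz f)) hg
  simp only [map_mul, map_one] at h1
  exact (mul_lt_one_of_lt_of_le hf (valued_seriesEval_le_one v hz g)).ne h1

theorem seriesEval_substAlgHom {τ : Type*} [Fintype τ] {z : Fin 2 → Field₂ k} {z' : τ → Field₂ k}
    (hz : ∀ i, v (z i) < 1) (hz' : ∀ i, v (z' i) < 1) {a : Fin 2 → MvPowerSeries τ k}
    (ha : MvPowerSeries.HasSubst a) (h : ∀ i, seriesEval v hz' (a i) = toCompletion v (z i))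
    (f : MvPowerSeries (Fin 2) k) :
    seriesEval v hz' (MvPowerSeries.substAlgHom (R := k) ha f) = seriesEval v hz f := by
  refine RingHom.congr_fun (ringHom_ext_of_valuation_le_one (w := Valued.v)
    (g := (seriesEval v hz').comp (MvPowerSeries.substAlgHom (R := k) ha).toRingHom)
    (fun f => valued_seriesEval_le_one v hz' _) (valued_seriesEval_le_one v hz) ?_ ?_ ?_) f
  · intro c
    rw [seriesEval_C]
    refine (congrArg (seriesEval v hz') ?_).trans (seriesEval_C v hz' c)
    exact (MvPowerSeries.substAlgHom (R := k) ha).commutes c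
  · intro i
    rw [seriesEval_X, ← h i]
    exact congrArg (seriesEval v hz') (MvPowerSeries.substAlgHom_X ha i)
  · intro i
    rw [seriesEval_X, valued_toCompletion]
    exact hz i

/-- The elements `z₁, z₂` have positive value, and `k[[X₁, X₂]]` is contained in `k[[z₁, z₂]]`:
the embedding of `k[[X₁, X₂]]` into the completion factors through the evaluation at `z`. -/
structure Dominates (z : Fin 2 → Field₂ k) : Prop where
  lt_one : ∀ i, v (z i) < 1
  factors : ∃ ψ : Ring₂ k →ₐ[k] MvPowerSeries (Fin 2) k, ∀ f,
    seriesEval v lt_one (ψ f) = toCompletion v (algebraMap (Ring₂ k) (Field₂ k) f)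

theorem valuation_coords_lt_one (i : Fin 2) : v (coords k i) < 1 :=
  (IsCentered.lt_one_iff _).mpr <| (IsLocalRing.mem_maximalIdeal _).mpr fun h => by
    simpa using MvPowerSeries.isUnit_iff_constantCoeff.mp h

theorem dominates_coords : Dominates v (coords k) where
  lt_one := valuation_coords_lt_one v
  factors := by
    refine ⟨AlgHom.id k _, fun f => ?_⟩
    refine RingHom.congr_fun (ringHom_ext_of_valuation_le_one (w := Valued.v)
      (h := (toCompletion v).comp (algebraMap (Ring₂ k) (Field₂ k)))
      (valued_seriesEval_le_one v _) (fun f => ?_) (fun c => ?_) (fun i => ?_) (fun i => ?_)) f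
    · rw [RingHom.comp_apply, valued_toCompletion]
      exact IsCentered.le_one f
    · rw [seriesEval_C, IsScalarTower.algebraMap_apply k (Ring₂ k) (Field₂ k)]
      rfl
    · rw [seriesEval_X]
      rfl
    · rw [RingHom.comp_apply, valued_toCompletion]
      exact valuation_coords_lt_one v i

variable {v}

theorem Dominates.of_subst {z z' : Fin 2 → Field₂ k} (h : Dominates v z)
    (hz' : ∀ i, v (z' i) < 1) {a : Fin 2 → MvPowerSeries (Fin 2) k}
    (ha : ∀ i, seriesEval v hz' (a i) = toCompletion v (z i)) : Dominates v z' := by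
  have hs : MvPowerSeries.HasSubst a := MvPowerSeries.hasSubst_of_constantCoeff_zero fun i =>
    constantCoeff_eq_zero_of_seriesEval_lt_one v hz'
      (by rw [ha, valued_toCompletion]; exact h.lt_one i)
  obtain ⟨ψ, hψ⟩ := h.factors
  exact ⟨hz', ((MvPowerSeries.substAlgHom hs).restrictScalars k).comp ψ, fun f =>
    (seriesEval_substAlgHom v h.lt_one hz' hs ha (ψ f)).trans (hψ f)⟩

theorem Dominates.blowUp {z z' : Fin 2 → Field₂ k} (h : Dominates v z) (hs : BlowUp v z z') :
    Dominates v z' := by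
  cases hs with
  | second z₁ z₂ h1 h2 =>
    have h0 : v z₁ ≠ 0 := (zero_le.trans_lt h2).ne'
    have hz₁ : z₁ ≠ 0 := by simpa using h0
    have hlt : ∀ i, v ((![z₁, z₂ / z₁] : Fin 2 → Field₂ k) i) < 1 := by
      intro i
      fin_cases i
      · exact h1
      · simpa using (div_lt_one₀ (zero_lt_iff.mpr h0)).mpr h2
    refine h.of_subst hlt (a := ![MvPowerSeries.X 0, MvPowerSeries.X 0 * MvPowerSeries.X 1]) ?_
    intro i
    fin_cases i
    · simp [seriesEval_X]
    · change seriesEval v hlt (MvPowerSeries.X 0 * MvPowerSeries.X 1) = toCompletion v z₂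
      rw [map_mul, seriesEval_X, seriesEval_X, ← map_mul]
      simp [mul_div_cancel₀ _ hz₁]
  | first z₁ z₂ h1 h2 =>
    have h0 : v z₂ ≠ 0 := (zero_le.trans_lt h2).ne'
    have hz₂ : z₂ ≠ 0 := by simpa using h0
    have hlt : ∀ i, v ((![z₁ / z₂, z₂] : Fin 2 → Field₂ k) i) < 1 := by
      intro i
      fin_cases i
      · simpa using (div_lt_one₀ (zero_lt_iff.mpr h0)).mpr h2
      · exact h1
    refine h.of_subst hlt (a := ![MvPowerSeries.X 0 * MvPowerSeries.X 1, MvPowerSeries.X 1]) ?_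
    intro i
    fin_cases i
    · change seriesEval v hlt (MvPowerSeries.X 0 * MvPowerSeries.X 1) = toCompletion v z₁
      rw [map_mul, seriesEval_X, seriesEval_X, ← map_mul]
      simp [div_mul_cancel₀ _ hz₂]
    · simp [seriesEval_X]

theorem Dominates.coordChange {z z' : Fin 2 → Field₂ k} (h : Dominates v z)
    (hs : CoordChange v z z') : Dominates v z' := by
  cases hs with
  | mk z₁ z₂ α h1 h2 h3 =>
    have hlt : ∀ i,
        v ((![z₁, z₂ - algebraMap k (Field₂ k) α * z₁] : Fin 2 → Field₂ k) i) < 1 := by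
      intro i
      fin_cases i
      · exact h1
      · exact h3.trans h1
    refine h.of_subst hlt (a := ![MvPowerSeries.X 0,
      MvPowerSeries.X 1 + MvPowerSeries.C α * MvPowerSeries.X 0]) ?_
    intro i
    fin_cases i
    · simp [seriesEval_X]
    · simp [seriesEval_X, seriesEval_C]

theorem Dominates.step {z z' : Fin 2 → Field₂ k} (h : Dominates v z) (hs : Step v z z') :
    Dominates v z' :=
  hs.elim h.blowUp h.coordChange

theorem dominates_of_reflTransGen {z : Fin 2 → Field₂ k}
    (h : Relation.ReflTransGen (Step v) (coords k) z) : Dominates v z := by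
  induction h with
  | refl => exact dominates_coords v
  | tail _ hs ih => exact ih.step hs

end Centered

/-! ### Power series expansions from digits -/

section Digits

variable {k : Type*} [Field k] {v : Valuation (Field₂ k) ℤᵐ⁰} [IsCentered v]

/-- If every element of a bounded set `S` is of the form `c + x * a'` with `c ∈ k` and `a' ∈ S`,
then the elements of `S` are power series in `x`. -/
theorem exists_seriesEval_eq_of_digits {x : Field₂ k} (hx : ∀ _ : Unit, v x < 1)
    {S : Set (Field₂ k)} (hS : ∀ a ∈ S, v a ≤ 1)
    (h : ∀ a ∈ S, ∃ c : k, ∃ a' ∈ S, a = algebraMap k (Field₂ k) c + x * a')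
    {a : Field₂ k} (ha : a ∈ S) :
    ∃ g : PowerSeries k, seriesEval v hx g = toCompletion v a := by
  choose! c s hs h using h
  have hiter : ∀ n : ℕ, ∀ a ∈ S, s^[n] a ∈ S := fun n => by
    induction n with
    | zero => exact fun a ha => ha
    | succ n ih => exact fun a ha => ih _ (hs a ha)
  let g : Field₂ k → PowerSeries k := fun a => PowerSeries.mk fun n => c (s^[n] a)
  have hg : ∀ a, g a = PowerSeries.C (c a) + PowerSeries.X * g (s a) := by
    intro a
    ext n
    cases n with
    | zero => simp [g]
    | succ n => simp [g, PowerSeries.coeff_succ_X_mul]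
  have key : ∀ n : ℕ, ∀ a ∈ S,
      Valued.v (seriesEval v hx (g a) - toCompletion v a) ≤ WithZero.exp (-(n : ℤ)) := by
    intro n
    induction n with
    | zero =>
      intro a ha
      refine ((Valued.v (R := v.Completion)).map_sub _ _).trans (max_le ?_ ?_)
      · simpa using valued_seriesEval_le_one v hx (g a)
      · simpa [valued_toCompletion] using hS a ha
    | succ n ih =>
      intro a ha
      have e : seriesEval v hx (g a) - toCompletion v a =
          toCompletion v x * (seriesEval v hx (g (s a)) - toCompletion v (s a)) := by
        have h0 : toCompletion v a = toCompletion v (algebraMap k (Field₂ k) (c a)) +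
            toCompletion v x * toCompletion v (s a) := by
          rw [← map_mul, ← map_add, ← h a ha]
        rw [hg a, h0, map_add, map_mul]
        have h1 : seriesEval v hx (PowerSeries.C (c a)) = _ := seriesEval_C v hx (c a)
        have h2 : seriesEval v hx (PowerSeries.X) = _ := seriesEval_X v hx ()
        rw [h1, h2]
        ring
      rw [e, map_mul, valued_toCompletion]
      refine (mul_le_mul' (lt_one_iff_le_exp_neg_one.mp (hx ())) (ih _ (hs a ha))).trans_eq ?_
      rw [← WithZero.exp_add]
      congr 1
      push_cast
      ring
  exact ⟨g a, sub_eq_zero.mp ((map_eq_zero _).mp (eq_zero_of_le_exp_neg fun n => key n a ha))⟩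

/-- If `k[[X₁, X₂]] ⊆ k[[x, y]]`, then `y` is not a power series in `x`, since otherwise
`k[[X₁, X₂]]` would embed into a power series ring in one variable. -/
theorem Dominates.seriesEval_ne {x y : Field₂ k} (h : Dominates v ![x, y])
    (hx : ∀ _ : Unit, v x < 1) (g : PowerSeries k) : seriesEval v hx g ≠ toCompletion v y := by
  intro hg
  obtain ⟨ψ, hψ⟩ := h.factors
  have ha : ∀ i, seriesEval v hx ((![PowerSeries.X, g] : Fin 2 → PowerSeries k) i) =
      toCompletion v ((![x, y] : Fin 2 → Field₂ k) i) := by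
    intro i
    fin_cases i
    · exact seriesEval_X v hx ()
    · exact hg
  have hs : MvPowerSeries.HasSubst (![PowerSeries.X, g] : Fin 2 → PowerSeries k) :=
    MvPowerSeries.hasSubst_of_constantCoeff_zero fun i =>
      constantCoeff_eq_zero_of_seriesEval_lt_one v hx
        (by rw [ha, valued_toCompletion]; exact h.lt_one i)
  refine not_injective_mvPowerSeries_to_powerSeries
    (((MvPowerSeries.substAlgHom (R := k) hs).restrictScalars k).comp ψ) fun f f' hf => ?_
  refine toCompletion_algebraMap_injective v ?_
  simp only
  rw [← hψ, ← hψ, ← seriesEval_substAlgHom v h.lt_one hx hs ha,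
    ← seriesEval_substAlgHom v h.lt_one hx hs ha]
  exact congrArg _ hf

end Digits

section Reduction

variable {k : Type*} [Field k] {v : Valuation (Field₂ k) ℤᵐ⁰}

theorem exists_eq_exp_neg {r : ℤᵐ⁰} (h0 : r ≠ 0) (h1 : r < 1) :
    ∃ n : ℕ, 0 < n ∧ r = WithZero.exp (-(n : ℤ)) := by
  rw [← WithZero.exp_log h0, ← WithZero.exp_zero, WithZero.exp_lt_exp] at h1
  refine ⟨(-WithZero.log r).toNat, by omega, ?_⟩
  rw [← WithZero.exp_log h0, WithZero.exp_inj, WithZero.log_exp]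
  omega

theorem exp_neg_lt_one {n : ℕ} (hn : 0 < n) : WithZero.exp (-(n : ℤ)) < 1 := by
  rw [← WithZero.exp_zero, WithZero.exp_lt_exp]
  omega

theorem exp_neg_div_exp_neg {a b : ℕ} (h : a ≤ b) :
    WithZero.exp (-(b : ℤ)) / WithZero.exp (-(a : ℤ)) = WithZero.exp (-((b - a : ℕ) : ℤ)) := by
  rw [← WithZero.exp_sub]
  congr 1
  omega

theorem blowUp_second_of_lt {x y : Field₂ k} {a b : ℕ} (ha : 0 < a) (hab : a < b)
    (hx : v x = WithZero.exp (-(a : ℤ))) (hy : v y = WithZero.exp (-(b : ℤ))) :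
    BlowUp v ![x, y] ![x, y / x] ∧ v (y / x) = WithZero.exp (-((b - a : ℕ) : ℤ)) := by
  refine ⟨BlowUp.second x y (hx ▸ exp_neg_lt_one ha) ?_, ?_⟩
  · rw [hx, hy, WithZero.exp_lt_exp]
    omega
  · rw [map_div₀, hx, hy, exp_neg_div_exp_neg hab.le]

theorem blowUp_first_of_lt {x y : Field₂ k} {a b : ℕ} (hb : 0 < b) (hab : b < a)
    (hx : v x = WithZero.exp (-(a : ℤ))) (hy : v y = WithZero.exp (-(b : ℤ))) :
    BlowUp v ![x, y] ![x / y, y] ∧ v (x / y) = WithZero.exp (-((a - b : ℕ) : ℤ)) := by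
  refine ⟨BlowUp.first x y (hy ▸ exp_neg_lt_one hb) ?_, ?_⟩
  · rw [hx, hy, WithZero.exp_lt_exp]
    omega
  · rw [map_div₀, hx, hy, exp_neg_div_exp_neg hab.le]

/-- The Euclidean algorithm on the values: blowing-ups lead to components of equal value. -/
theorem exists_blowUps_balanced (n : ℕ) : ∀ {a b : ℕ} {x y : Field₂ k}, a + b ≤ n → 0 < a → 0 < b →
    v x = WithZero.exp (-(a : ℤ)) → v y = WithZero.exp (-(b : ℤ)) →
    ∃ (x' y' : Field₂ k) (c : ℕ), Relation.ReflTransGen (BlowUp v) ![x, y] ![x', y'] ∧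
      0 < c ∧ c ≤ a ∧ c ≤ b ∧ v x' = WithZero.exp (-(c : ℤ)) ∧ v y' = WithZero.exp (-(c : ℤ)) := by
  induction n with
  | zero => intros; omega
  | succ n ih =>
    intro a b x y hn ha hb hx hy
    rcases lt_trichotomy a b with hab | rfl | hab
    · obtain ⟨hs, hv⟩ := blowUp_second_of_lt ha hab hx hy
      obtain ⟨x', y', c, hr, hc, h1, h2, hx', hy'⟩ := ih (by omega) ha (by omega) hx hv
      exact ⟨x', y', c, .head hs hr, hc, by omega, by omega, hx', hy'⟩
    · exact ⟨x, y, a, .refl, ha, le_rfl, le_rfl, hx, hy⟩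
    · obtain ⟨hs, hv⟩ := blowUp_first_of_lt hb hab hx hy
      obtain ⟨x', y', c, hr, hc, h1, h2, hx', hy'⟩ := ih (by omega) (by omega) hb hv hy
      exact ⟨x', y', c, .head hs hr, hc, by omega, by omega, hx', hy'⟩

/-- If `y` has larger value than `x`, blowing-ups either remove a power of `x` from `y` so that the
values agree, or lead to components of equal value smaller than that of `x`. -/
theorem exists_blowUps_div_pow_or_lt (n : ℕ) : ∀ {a b : ℕ} {x y : Field₂ k}, b ≤ n → 0 < a →
    a < b → v x = WithZero.exp (-(a : ℤ)) → v y = WithZero.exp (-(b : ℤ)) →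
    (∃ m : ℕ, Relation.ReflTransGen (BlowUp v) ![x, y] ![x, y / x ^ (m + 1)] ∧
      v (y / x ^ (m + 1)) = WithZero.exp (-(a : ℤ))) ∨
    ∃ (x' y' : Field₂ k) (c : ℕ), Relation.ReflTransGen (BlowUp v) ![x, y] ![x', y'] ∧
      0 < c ∧ c < a ∧ v x' = WithZero.exp (-(c : ℤ)) ∧ v y' = WithZero.exp (-(c : ℤ)) := by
  induction n with
  | zero => intros; omega
  | succ n ih =>
    intro a b x y hn ha hab hx hy
    obtain ⟨hs, hv⟩ := blowUp_second_of_lt ha hab hx hy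
    rcases lt_trichotomy a (b - a) with h | h | h
    · rcases ih (by omega) ha h hx hv with ⟨m, hr, hm⟩ | ⟨x', y', c, hr, h'⟩
      · rw [div_div, ← pow_succ'] at hr hm
        exact .inl ⟨m + 1, .head hs hr, hm⟩
      · exact .inr ⟨x', y', c, .head hs hr, h'⟩
    · refine .inl ⟨0, ?_, ?_⟩
      · simpa using Relation.ReflTransGen.single hs
      · simpa [← h] using hv
    · obtain ⟨x', y', c, hr, hc, h1, h2, hx', hy'⟩ :=
        exists_blowUps_balanced _ le_rfl ha (by omega) hx hv
      exact .inr ⟨x', y', c, .head hs hr, hc, by omega, hx', hy'⟩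

theorem reflTransGen_step_of_blowUp {z z' : Fin 2 → Field₂ k}
    (h : Relation.ReflTransGen (BlowUp v) z z') : Relation.ReflTransGen (Step v) z z' :=
  Relation.ReflTransGen.mono (fun _ _ => Or.inl) _ _ h

variable (v) in
/-- The components of the pair have the same finite positive value, and no coordinate change over
`k` applies to it. -/
structure IsTerminal (z : Fin 2 → Field₂ k) : Prop where
  lt_one : v (z 0) < 1
  ne_zero : v (z 0) ≠ 0
  eq : v (z 1) = v (z 0)
  not_lt : ∀ α : k, ¬ v (z 1 - algebraMap k (Field₂ k) α * z 0) < v (z 0)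

variable [IsCentered v]

/-- The process reaches a pair admitting no coordinate change. By induction on the common value of
the components, an infinite process may be assumed to fix the first component `x`; the second
component would then be a power series in `x`. -/
theorem exists_isTerminal_of_balanced (n : ℕ) : ∀ {a : ℕ} {x y : Field₂ k}, a ≤ n → 0 < a →
    Relation.ReflTransGen (Step v) (coords k) ![x, y] →
    v x = WithZero.exp (-(a : ℤ)) → v y = WithZero.exp (-(a : ℤ)) →
    ∃ z, Relation.ReflTransGen (Step v) (coords k) z ∧ IsTerminal v z := by
  induction n with
  | zero => intros; omega
  | succ n ih =>
    intro a x y hn ha hr hx hy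
    by_contra hno
    have hxlt : v x < 1 := hx ▸ exp_neg_lt_one ha
    have hxv : v x ≠ 0 := by simp [hx]
    have hx0 : x ≠ 0 := by simpa using hxv
    -- up to powers of `x`, with exponent at least `-1`, the second components of all pairs reached
    -- with first component `x`: this set is closed under taking off a constant and dividing by `x`
    let S : Set (Field₂ k) := {f | f = 0 ∨ ∃ (y : Field₂ k) (j : ℕ),
      Relation.ReflTransGen (Step v) (coords k) ![x, y] ∧ v y = v x ∧ f * x = x ^ j * y}
    have hS1 : ∀ f ∈ S, v f ≤ 1 := by
      rintro f (rfl | ⟨y, j, -, hy, hf⟩)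
      · simp
      · have h := congrArg v hf
        rw [map_mul, map_mul, hy] at h
        rw [mul_right_cancel₀ hxv h, map_pow]
        exact pow_le_one₀ zero_le hxlt.le
    have hS2 : ∀ f ∈ S, ∃ c : k, ∃ f' ∈ S, f = algebraMap k (Field₂ k) c + x * f' := by
      rintro f (rfl | ⟨y, j, hr, hy, hf⟩)
      · exact ⟨0, 0, .inl rfl, by simp⟩
      cases j with
      | succ j =>
        refine ⟨0, f / x, .inr ⟨y, j, hr, hy, ?_⟩, by simp [mul_div_cancel₀ _ hx0]⟩
        rw [div_mul_cancel₀ _ hx0]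
        apply mul_right_cancel₀ hx0
        rw [hf]
        ring
      | zero =>
        rw [pow_zero, one_mul] at hf
        obtain ⟨α, hα⟩ : ∃ α : k, v (y - algebraMap k (Field₂ k) α * x) < v x := by
          by_contra! h
          exact hno ⟨_, hr, hxlt, hxv, hy, fun α => (h α).not_gt⟩
        have hr' := hr.tail (.inr (CoordChange.mk x y α hxlt hy hα))
        set w := y - algebraMap k (Field₂ k) α * x with hw
        refine ⟨α, w / x ^ 2, ?_, ?_⟩
        · rcases eq_or_ne w 0 with h0 | h0
          · exact .inl (by simp [h0])
          obtain ⟨b, -, hb⟩ := exists_eq_exp_neg (r := v w) (by simpa using h0) (hα.trans hxlt)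
          have hab : a < b := by
            rw [hx, hb, WithZero.exp_lt_exp] at hα
            omega
          rcases exists_blowUps_div_pow_or_lt b le_rfl ha hab hx hb with
            ⟨m, hrm, hm⟩ | ⟨x', y', c, hrc, hc, hca, hx', hy'⟩
          · refine .inr ⟨w / x ^ (m + 1), m, hr'.trans (reflTransGen_step_of_blowUp hrm),
              hm.trans hx.symm, ?_⟩
            field_simp
            ring
          · exact absurd
              (ih (by omega) hc (hr'.trans (reflTransGen_step_of_blowUp hrc)) hx' hy') hno
        · have : f = y / x := by rw [← hf, mul_div_cancel_right₀ _ hx0]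
          rw [this, hw]
          field_simp
          ring
    obtain ⟨g, hg⟩ := exists_seriesEval_eq_of_digits (fun _ => hxlt) hS1 hS2
      (a := y) (.inr ⟨y, 1, hr, hy.trans hx.symm, by ring⟩)
    exact (dominates_of_reflTransGen hr).seriesEval_ne _ g hg

variable (v) in
theorem exists_isTerminal :
    ∃ z, Relation.ReflTransGen (Step v) (coords k) z ∧ IsTerminal v z := by
  obtain ⟨a, ha, hx⟩ :=
    exists_eq_exp_neg (valuation_coords_ne_zero v 0) (valuation_coords_lt_one v 0)
  obtain ⟨b, hb, hy⟩ :=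
    exists_eq_exp_neg (valuation_coords_ne_zero v 1) (valuation_coords_lt_one v 1)
  obtain ⟨x', y', c, hr, hc, -, -, hx', hy'⟩ := exists_blowUps_balanced _ le_rfl ha hb hx hy
  have e : coords k = ![coords k 0, coords k 1] := by
    ext i
    fin_cases i <;> rfl
  rw [← e] at hr
  exact exists_isTerminal_of_balanced c le_rfl hc (reflTransGen_step_of_blowUp hr) hx' hy'

end Reduction

/-! ### Monomial valuations -/

section Monomial

variable {k : Type*} [Field k] {v : Valuation (Field₂ k) ℤᵐ⁰}

theorem ofOrder_natCast (n : ℕ) : ofOrder n = WithZero.exp (-(n : ℤ)) := by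
  simp [ofOrder]

theorem exp_neg_le_ofOrder {N : ℕ∞} {n : ℕ} (h : N ≤ n) : WithZero.exp (-(n : ℤ)) ≤ ofOrder N := by
  obtain ⟨m, rfl⟩ := ENat.ne_top_iff_exists.mp (ne_top_of_le_ne_top (ENat.natCast_ne_top n) h)
  rw [ofOrder_natCast, WithZero.exp_le_exp]
  have := Nat.cast_le.mp h
  omega

/-- For a monomial valuation, two powers of distinct variables have no cancellation. -/
theorem exp_neg_le_valuation_sub_of_isMonomialWith {B : Fin 2 → ℕ}
    (hB : IsMonomialWith (fun f => v (algebraMap (Ring₂ k) (Field₂ k) f)) B) {i j : Fin 2}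
    (hij : i ≠ j) {m n : ℕ} (hm : m ≠ 0) {α : k} (hα : α ≠ 0) :
    WithZero.exp (-((n * B j : ℕ) : ℤ)) ≤
      v (coords k i ^ m - algebraMap k (Field₂ k) α * coords k j ^ n) := by
  classical
  have e : coords k i ^ m - algebraMap k (Field₂ k) α * coords k j ^ n =
      algebraMap (Ring₂ k) (Field₂ k)
        (MvPowerSeries.X i ^ m - MvPowerSeries.C α * MvPowerSeries.X j ^ n) := by
    rw [map_sub, map_mul, map_pow, map_pow, IsScalarTower.algebraMap_apply k (Ring₂ k) (Field₂ k)]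
    rfl
  rw [e]
  refine (exp_neg_le_ofOrder ?_).trans_eq (hB.eq _).symm
  refine (MvPowerSeries.weightedOrder_le B (d := Finsupp.single j n) ?_).trans_eq ?_
  · have : Finsupp.single j n ≠ Finsupp.single i m := fun h => by
      have := DFunLike.congr_fun h i
      simp [hij.symm, hm.symm] at this
    simp [MvPowerSeries.coeff_X_pow, this, hα]
  · simp [Finsupp.weight_single]

theorem valuation_coords_of_isMonomialWith {B : Fin 2 → ℕ}
    (hB : IsMonomialWith (fun f => v (algebraMap (Ring₂ k) (Field₂ k) f)) B) (i : Fin 2) :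
    v (coords k i) = WithZero.exp (-(B i : ℤ)) := by
  refine (hB.eq _).trans ?_
  rw [← ofOrder_natCast, MvPowerSeries.X,
    MvPowerSeries.weightedOrder_monomial_of_ne_zero _ one_ne_zero]
  simp [Finsupp.weight_single]

/-- The components of a pair obtained by blowing-ups are Laurent monomials in the variables, with a
unimodular matrix of exponents. -/
theorem exists_zpow_of_blowUps {z : Fin 2 → Field₂ k}
    (h : Relation.ReflTransGen (BlowUp v) (coords k) z) :
    ∃ a b c d : ℤ, z 0 = coords k 0 ^ a * coords k 1 ^ b ∧ z 1 = coords k 0 ^ c * coords k 1 ^ d ∧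
      a * d - b * c = 1 := by
  have h0 : coords k 0 ≠ 0 := by simpa using valuation_coords_ne_zero v 0
  have h1 : coords k 1 ≠ 0 := by simpa using valuation_coords_ne_zero v 1
  induction h with
  | refl => exact ⟨1, 0, 0, 1, by simp, by simp, by simp⟩
  | tail _ hs ih =>
    obtain ⟨a, b, c, d, hx, hy, hdet⟩ := ih
    cases hs with
    | second x y _ _ =>
      simp only [Matrix.cons_val_zero, Matrix.cons_val_one] at hx hy
      refine ⟨a, b, c - a, d - b, hx, ?_, by linarith⟩
      change y / x = _
      rw [hx, hy, zpow_sub₀ h0, zpow_sub₀ h1, div_mul_div_comm]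
    | first x y _ _ =>
      simp only [Matrix.cons_val_zero, Matrix.cons_val_one] at hx hy
      refine ⟨a - c, b - d, c, d, ?_, hy, by linarith⟩
      change x / y = _
      rw [hx, hy, zpow_sub₀ h0, zpow_sub₀ h1, div_mul_div_comm]

/-- If the valuation is monomial, the blowing-ups of the Euclidean algorithm suffice: a Laurent
monomial of value zero which is not constant is not congruent to an element of `k`. -/
theorem exists_isTerminal_of_isMonomial
    (hmon : IsMonomial (fun f => v (algebraMap (Ring₂ k) (Field₂ k) f))) :
    ∃ z, Relation.ReflTransGen (BlowUp v) (coords k) z ∧ IsTerminal v z := by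
  obtain ⟨B, hB⟩ := hmon
  have hX := valuation_coords_of_isMonomialWith hB
  have hX0 : ∀ i, coords k i ≠ 0 := fun i => by simpa using valuation_coords_ne_zero v i
  obtain ⟨x, y, e, hr, he, -, -, hx, hy⟩ :=
    exists_blowUps_balanced _ le_rfl (hB.pos 0) (hB.pos 1) (hX 0) (hX 1)
  have hcoords : coords k = ![coords k 0, coords k 1] := by
    ext i
    fin_cases i <;> rfl
  rw [← hcoords] at hr
  refine ⟨_, hr, hx ▸ exp_neg_lt_one he, by simp [hx], hy.trans hx.symm, fun α hα => ?_⟩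
  obtain ⟨a, b, c, d, hxe, hye, hdet⟩ := exists_zpow_of_blowUps hr
  simp only [Matrix.cons_val_zero, Matrix.cons_val_one] at hα hxe hye
  have hxv : v x ≠ 0 := by simp [hx]
  have hx0 : x ≠ 0 := by simpa using hxv
  -- the quotient `y / x` is a Laurent monomial of value zero
  obtain ⟨w, hw⟩ : ∃ w, w = y / x := ⟨_, rfl⟩
  have hwv : v w = 1 := by rw [hw, map_div₀, hx, hy, div_self (by simp)]
  have hwα : v (w - algebraMap k (Field₂ k) α) < 1 := by
    have : w - algebraMap k (Field₂ k) α = (y - algebraMap k (Field₂ k) α * x) / x := by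
      rw [hw]
      field_simp
    rw [this, map_div₀]
    exact (div_lt_one₀ (zero_lt_iff.mpr hxv)).mpr hα
  have hα0 : α ≠ 0 := by
    rintro rfl
    simp [hwv] at hwα
  obtain ⟨p, hp⟩ : ∃ p, p = c - a := ⟨_, rfl⟩
  obtain ⟨q, hq⟩ : ∃ q, q = d - b := ⟨_, rfl⟩
  have hwe : w = coords k 0 ^ p * coords k 1 ^ q := by
    rw [hw, hxe, hye, hp, hq, zpow_sub₀ (hX0 0), zpow_sub₀ (hX0 1), div_mul_div_comm]
  have hpq : p * B 0 + q * B 1 = 0 := by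
    rw [hwe, map_mul, map_zpow₀, map_zpow₀, hX, hX, ← WithZero.exp_zsmul, ← WithZero.exp_zsmul,
      ← WithZero.exp_add, WithZero.exp_eq_one] at hwv
    simp only [smul_eq_mul] at hwv
    linarith
  have hB0 : (0 : ℤ) < B 0 := by exact_mod_cast hB.pos 0
  have hB1 : (0 : ℤ) < B 1 := by exact_mod_cast hB.pos 1
  rcases lt_trichotomy p 0 with h | h | h
  · have hq0 : 0 < q := by nlinarith
    obtain ⟨m, hm⟩ := Int.eq_ofNat_of_zero_le (neg_pos.mpr h).le
    obtain ⟨n, hn⟩ := Int.eq_ofNat_of_zero_le hq0.le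
    have hle := exp_neg_le_valuation_sub_of_isMonomialWith hB (i := 1) (j := 0) (by decide)
      (m := n) (n := m) (by omega) hα0
    have : coords k 1 ^ n - algebraMap k (Field₂ k) α * coords k 0 ^ m =
        coords k 0 ^ m * (w - algebraMap k (Field₂ k) α) := by
      rw [hwe, hn, show p = -(m : ℤ) by omega, zpow_neg, zpow_natCast, zpow_natCast]
      have := hX0 0
      field_simp
    rw [this, map_mul, map_pow, hX, ← WithZero.exp_nsmul] at hle
    refine absurd hle (not_le.mpr ?_)
    refine (mul_lt_of_lt_one_right (WithZero.exp_pos) hwα).trans_eq ?_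
    congr 1
    simp
  · have hq0 : q = 0 := by
      rw [h, zero_mul, zero_add] at hpq
      exact (mul_eq_zero.mp hpq).resolve_right hB1.ne'
    have h1 : c = a := by omega
    have h2 : d = b := by omega
    rw [h1, h2] at hdet
    linarith
  · have hq0 : q < 0 := by nlinarith
    obtain ⟨m, hm⟩ := Int.eq_ofNat_of_zero_le h.le
    obtain ⟨n, hn⟩ := Int.eq_ofNat_of_zero_le (neg_pos.mpr hq0).le
    have hle := exp_neg_le_valuation_sub_of_isMonomialWith hB (i := 0) (j := 1) (by decide)
      (m := m) (n := n) (by omega) hα0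
    have : coords k 0 ^ m - algebraMap k (Field₂ k) α * coords k 1 ^ n =
        coords k 1 ^ n * (w - algebraMap k (Field₂ k) α) := by
      rw [hwe, hm, show q = -(n : ℤ) by omega, zpow_neg, zpow_natCast, zpow_natCast]
      have := hX0 1
      field_simp
    rw [this, map_mul, map_pow, hX, ← WithZero.exp_nsmul] at hle
    refine absurd hle (not_le.mpr ?_)
    refine (mul_lt_of_lt_one_right (WithZero.exp_pos) hwα).trans_eq ?_
    congr 1
    simp

end Monomial

/-! ### Leading forms -/

section LeadingForm

variable {k : Type*} [Field k]

/-- The homogeneous component of degree `n` of a power series in two variables `X₁, X₂`,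
dehomogenized by `X₁ = 1`. -/
noncomputable def formPoly (f : MvPowerSeries (Fin 2) k) (n : ℕ) : Polynomial k :=
  ∑ j ∈ Finset.range (n + 1), Polynomial.monomial j
    (MvPowerSeries.coeff (Finsupp.single 0 (n - j) + Finsupp.single 1 j) f)

theorem coeff_formPoly (f : MvPowerSeries (Fin 2) k) (n j : ℕ) :
    (formPoly f n).coeff j = if j < n + 1 then
      MvPowerSeries.coeff (Finsupp.single 0 (n - j) + Finsupp.single 1 j) f else 0 := by
  simp [formPoly, Polynomial.coeff_monomial, Finset.sum_ite_eq']

theorem weight_one_eq (A : Fin 2 →₀ ℕ) : Finsupp.weight (fun _ : Fin 2 => 1) A = A 0 + A 1 := by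
  simp [Finsupp.weight_apply, Finsupp.sum_fintype]

theorem eq_single_add_single (A : Fin 2 →₀ ℕ) :
    A = Finsupp.single 0 (A 0) + Finsupp.single 1 (A 1) := by
  ext i
  fin_cases i <;> simp

theorem formPoly_eq_zero_of_lt {f : MvPowerSeries (Fin 2) k} {n : ℕ}
    (h : (n : ℕ∞) < f.weightedOrder fun _ => 1) : formPoly f n = 0 := by
  ext j
  rw [coeff_formPoly, Polynomial.coeff_zero]
  split_ifs with hj
  · refine MvPowerSeries.coeff_eq_zero_of_lt_weightedOrder _ (lt_of_eq_of_lt ?_ h)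
    rw [weight_one_eq]
    congr 1
    simp
    omega
  · rfl

theorem formPoly_ne_zero {f : MvPowerSeries (Fin 2) k} {n : ℕ}
    (h : f.weightedOrder (fun _ => 1) = n) : formPoly f n ≠ 0 := by
  obtain ⟨⟨A, hA, hAn⟩, -⟩ := (MvPowerSeries.weightedOrder_eq_nat _).mp h
  rw [weight_one_eq] at hAn
  intro h0
  have := congrArg (fun P => P.coeff (A 1)) h0
  simp only [coeff_formPoly, Polynomial.coeff_zero] at this
  rw [if_pos (by omega), show n - A 1 = A 0 by omega, ← eq_single_add_single] at this
  exact hA this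

theorem coeff_lineSubst {F : Type*} [Field F] [Algebra k F] (u : F) (f : MvPowerSeries (Fin 2) k)
    (n : ℕ) : PowerSeries.coeff n (lineSubst k u f) = Polynomial.aeval u (formPoly f n) := by
  classical
  have hsub : MvPowerSeries.HasSubst
      ![(PowerSeries.X : PowerSeries F), PowerSeries.C u * PowerSeries.X] :=
    MvPowerSeries.hasSubst_of_constantCoeff_zero (by
      intro s
      change PowerSeries.constantCoeff _ = 0
      fin_cases s <;> simp)
  have hterm : ∀ A : Fin 2 →₀ ℕ, PowerSeries.coeff n
      (A.prod fun s e =>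
        (![(PowerSeries.X : PowerSeries F), PowerSeries.C u * PowerSeries.X] s) ^ e) =
      if A 0 + A 1 = n then u ^ A 1 else 0 := by
    intro A
    rw [Finsupp.prod_fintype _ _ (by simp)]
    have : ∏ i, (![(PowerSeries.X : PowerSeries F), PowerSeries.C u * PowerSeries.X] i) ^ A i =
        PowerSeries.C (u ^ A 1) * PowerSeries.X ^ (A 0 + A 1) := by
      simp only [Fin.prod_univ_two, Matrix.cons_val_zero, Matrix.cons_val_one]
      rw [mul_pow, map_pow, pow_add]
      ring
    rw [this, PowerSeries.coeff_C_mul_X_pow]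
    simp only [eq_comm]
  change MvPowerSeries.coeff (Finsupp.single () n) (MvPowerSeries.substAlgHom hsub f) = _
  rw [MvPowerSeries.substAlgHom_apply, MvPowerSeries.coeff_subst hsub]
  have hinj : Set.InjOn (fun j : ℕ => (Finsupp.single 0 (n - j) + Finsupp.single 1 j : Fin 2 →₀ ℕ))
      (Finset.range (n + 1)) := by
    intro j _ j' _ h
    simpa using DFunLike.congr_fun h 1
  rw [finsum_eq_sum_of_support_subset (s := (Finset.range (n + 1)).image
    fun j => (Finsupp.single 0 (n - j) + Finsupp.single 1 j : Fin 2 →₀ ℕ)), Finset.sum_image hinj,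
    formPoly, map_sum]
  · refine Finset.sum_congr rfl fun j hj => ?_
    have hj' : n - j + j = n := Nat.sub_add_cancel (by simpa [Nat.lt_succ_iff] using hj)
    have := hterm (Finsupp.single 0 (n - j) + Finsupp.single 1 j)
    change _ • PowerSeries.coeff n _ = _
    rw [this, Polynomial.aeval_monomial, Algebra.smul_def]
    simp [hj']
  · intro A hA
    have h1 : PowerSeries.coeff n (A.prod fun s e =>
        (![(PowerSeries.X : PowerSeries F), PowerSeries.C u * PowerSeries.X] s) ^ e) ≠ 0 :=
      fun h => hA (by change _ • PowerSeries.coeff n _ = _; rw [h, smul_zero])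
    rw [hterm] at h1
    have h2 : A 0 + A 1 = n := by
      by_contra h
      exact h1 (if_neg h)
    simp only [Finset.coe_image, Set.mem_image, Finset.mem_coe, Finset.mem_range]
    exact ⟨A 1, by omega, by rw [show n - A 1 = A 0 by omega, ← eq_single_add_single]⟩

theorem order_lineSubst {F : Type*} [Field F] [Algebra k F] {u : F} (hu : Transcendental k u)
    (f : MvPowerSeries (Fin 2) k) :
    (lineSubst k u f).order = f.weightedOrder fun _ => 1 := by
  rcases eq_or_ne f 0 with rfl | hf
  · simp
  have hn := (MvPowerSeries.ne_zero_iff_weightedOrder_finite (fun _ => 1)).mp hf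
  rw [← hn, PowerSeries.order_eq_nat]
  constructor
  · rw [coeff_lineSubst]
    exact fun h => formPoly_ne_zero hn.symm ((transcendental_iff.mp hu) _ h)
  · intro i hi
    rw [coeff_lineSubst, formPoly_eq_zero_of_lt, map_zero]
    rw [← hn]
    exact_mod_cast hi

theorem lineSubst_injective {F : Type*} [Field F] [Algebra k F] {u : F} (hu : Transcendental k u) :
    Function.Injective (lineSubst k u) := by
  rw [injective_iff_map_eq_zero]
  intro f hf
  rw [← MvPowerSeries.weightedOrder_eq_top_iff (fun _ => 1), ← order_lineSubst hu, hf,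
    PowerSeries.order_zero]

variable {v : Valuation (Field₂ k) ℤᵐ⁰} [IsCentered v]

/-- If `f` has order at least `n`, then `f(z₁, z₂)` agrees up to higher order with the value of its
homogeneous component of degree `n`. -/
theorem valued_seriesEval_sub_le {z : Fin 2 → Field₂ k} (hz : ∀ i, v (z i) < 1) {a : ℕ}
    (hza : ∀ i, v (z i) = WithZero.exp (-(a : ℤ))) {f : MvPowerSeries (Fin 2) k} {n : ℕ}
    (hn : (n : ℕ∞) ≤ f.weightedOrder fun _ => 1) :
    Valued.v (seriesEval v hz f -
      toCompletion v (z 0 ^ n * Polynomial.aeval (z 1 / z 0) (formPoly f n))) ≤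
      WithZero.exp (-((a * (n + 1) : ℕ) : ℤ)) := by
  classical
  have hz0 : z 0 ≠ 0 := by
    rw [← map_ne_zero v, hza]
    simp
  -- the homogeneous component of degree `n`
  obtain ⟨p, hp⟩ : ∃ p : MvPowerSeries (Fin 2) k, p = ∑ j ∈ Finset.range (n + 1),
    MvPowerSeries.C (MvPowerSeries.coeff (Finsupp.single 0 (n - j) + Finsupp.single 1 j) f) *
      (MvPowerSeries.X 0 ^ (n - j) * MvPowerSeries.X 1 ^ j) := ⟨_, rfl⟩
  have hpe : seriesEval v hz p =
      toCompletion v (z 0 ^ n * Polynomial.aeval (z 1 / z 0) (formPoly f n)) := by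
    rw [hp, formPoly, map_sum, map_sum, Finset.mul_sum, map_sum]
    refine Finset.sum_congr rfl fun j hj => ?_
    have hj' : n - j + j = n := Nat.sub_add_cancel (by simpa [Nat.lt_succ_iff] using hj)
    rw [map_mul, map_mul, map_pow, map_pow, seriesEval_C, seriesEval_X, seriesEval_X,
      Polynomial.aeval_monomial, ← map_pow, ← map_pow, ← map_mul, ← map_mul]
    congr 1
    rw [div_pow]
    have hpow : z 0 ^ n = z 0 ^ (n - j) * z 0 ^ j := by rw [← pow_add, hj']
    rw [hpow]
    field_simp
  have hpc : ∀ A, A 0 + A 1 ≤ n → MvPowerSeries.coeff A (f - p) = 0 := by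
    intro A hA
    have hc : ∀ j, MvPowerSeries.coeff A
        (MvPowerSeries.C (MvPowerSeries.coeff (Finsupp.single 0 (n - j) + Finsupp.single 1 j) f) *
          (MvPowerSeries.X 0 ^ (n - j) * MvPowerSeries.X 1 ^ j)) =
        if A = Finsupp.single 0 (n - j) + Finsupp.single 1 j then
          MvPowerSeries.coeff (Finsupp.single 0 (n - j) + Finsupp.single 1 j) f else 0 := by
      intro j
      rw [MvPowerSeries.coeff_C_mul, MvPowerSeries.X_pow_eq, MvPowerSeries.X_pow_eq,
        MvPowerSeries.monomial_mul_monomial, MvPowerSeries.coeff_monomial]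
      simp
    rw [map_sub, hp, map_sum]
    simp only [hc]
    rcases hA.lt_or_eq with h | h
    · rw [MvPowerSeries.coeff_eq_zero_of_lt_weightedOrder (fun _ => 1)
        (lt_of_lt_of_le (by rw [weight_one_eq]; exact_mod_cast h) hn), zero_sub, neg_eq_zero]
      refine Finset.sum_eq_zero fun j hj => if_neg ?_
      rintro rfl
      simp at h hj
      omega
    · rw [Finset.sum_eq_single (A 1)]
      · rw [if_pos, show n - A 1 = A 0 by omega, ← eq_single_add_single, sub_self]
        rw [show n - A 1 = A 0 by omega, ← eq_single_add_single]
      · intro j _ hj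
        refine if_neg ?_
        rintro rfl
        simp at hj
      · intro hA'
        simp at hA'
        omega
  rw [← hpe, ← map_sub]
  refine valuation_evalHom_le _ _ fun A => ?_
  rcases le_or_gt (A 0 + A 1) n with h | h
  · simp [seriesTerm, hpc A h]
  · refine (valuation_seriesTerm_le (valued_constants_le_one v) (b := a) (fun i => ?_) _ _).trans ?_
    · rw [valued_toCompletion, hza]
    · rw [WithZero.exp_le_exp, neg_le_neg_iff, Nat.cast_le, Finsupp.degree_eq_sum,
        Fin.sum_univ_two]
      exact Nat.mul_le_mul_left a h

end LeadingForm

/-! ### The valuation at a terminal pair -/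

section Terminal

variable {k : Type*} [Field k] {v : Valuation (Field₂ k) ℤᵐ⁰}

theorem residue_eq_residue_iff {a b : v.valuationSubring} :
    IsLocalRing.residue v.valuationSubring a = IsLocalRing.residue v.valuationSubring b ↔
      v ((a : Field₂ k) - b) < 1 := by
  rw [← sub_eq_zero, ← map_sub, IsLocalRing.residue_eq_zero_iff, Valuation.mem_maximalIdeal_iff]
  rfl

variable [IsCentered v]

theorem transcendental_residue_of_isTerminal [IsAlgClosed k] {z : Fin 2 → Field₂ k}
    (hz : IsTerminal v z) (h : z 1 / z 0 ∈ v.valuationSubring) :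
    Transcendental k (IsLocalRing.residue v.valuationSubring ⟨z 1 / z 0, h⟩) := by
  intro hu
  obtain ⟨α, hα⟩ := minpoly.degree_eq_one_iff.mp
    (IsAlgClosed.degree_eq_one_of_irreducible k (minpoly.irreducible hu.isIntegral))
  have hlt : v (z 1 / z 0 - algebraMap k (Field₂ k) α) < 1 :=
    (residue_eq_residue_iff (v := v) (a := ⟨z 1 / z 0, h⟩)
      (b := algebraMap k v.valuationSubring α)).mp hα.symm
  refine hz.not_lt α ?_
  have hz0 : z 0 ≠ 0 := (map_ne_zero v).mp hz.ne_zero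
  have : z 1 - algebraMap k (Field₂ k) α * z 0 = (z 1 / z 0 - algebraMap k (Field₂ k) α) * z 0 := by
    field_simp
  rw [this, map_mul]
  exact mul_lt_of_lt_one_left (zero_lt_iff.mpr hz.ne_zero) hlt

theorem coe_aeval_valuationSubring (w : v.valuationSubring) (P : Polynomial k) :
    ((Polynomial.aeval w P : v.valuationSubring) : Field₂ k) = Polynomial.aeval (w : Field₂ k) P :=
  Polynomial.hom_eval₂ P (algebraMap k v.valuationSubring) v.valuationSubring.subtype w

theorem residue_aeval (w : v.valuationSubring) (P : Polynomial k) :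
    IsLocalRing.residue v.valuationSubring (Polynomial.aeval w P) =
      Polynomial.aeval (IsLocalRing.residue v.valuationSubring w) P :=
  Polynomial.hom_eval₂ P (algebraMap k v.valuationSubring) (IsLocalRing.residue _) w

theorem valuation_aeval_eq_one {w : v.valuationSubring}
    (hw : Transcendental k (IsLocalRing.residue v.valuationSubring w)) {P : Polynomial k}
    (hP : P ≠ 0) : v (Polynomial.aeval (w : Field₂ k) P) = 1 := by
  rw [← coe_aeval_valuationSubring]
  refine le_antisymm (Polynomial.aeval w P).2 (not_lt.mp fun h => hP ?_)
  refine transcendental_iff.mp hw P ?_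
  rw [← residue_aeval, IsLocalRing.residue_eq_zero_iff, Valuation.mem_maximalIdeal_iff]
  exact h

theorem ne_zero_of_factors {σ : Type*} [Fintype σ] {z : σ → Field₂ k} {hz : ∀ i, v (z i) < 1}
    {ψ : Ring₂ k →ₐ[k] MvPowerSeries σ k}
    (hψ : ∀ f, seriesEval v hz (ψ f) = toCompletion v (algebraMap (Ring₂ k) (Field₂ k) f))
    {f : Ring₂ k} (hf : f ≠ 0) : ψ f ≠ 0 := by
  intro h0
  refine hf (toCompletion_algebraMap_injective v ?_)
  simp only
  rw [← hψ, h0]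
  simp

/-- If the components of `z` have value `a` and the residue of `z₂ / z₁` is transcendental, then
the value of `f(z₁, z₂)` is `a` times the order of `f`: the value of the leading form is not
raised by cancellation. -/
theorem valued_seriesEval_eq {z : Fin 2 → Field₂ k} (hz : ∀ i, v (z i) < 1) {a : ℕ} (ha : 0 < a)
    (hza : ∀ i, v (z i) = WithZero.exp (-(a : ℤ))) (h : z 1 / z 0 ∈ v.valuationSubring)
    (hu : Transcendental k (IsLocalRing.residue v.valuationSubring ⟨z 1 / z 0, h⟩))
    {f : MvPowerSeries (Fin 2) k} {n : ℕ} (hn : f.weightedOrder (fun _ => 1) = n) :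
    Valued.v (seriesEval v hz f) = WithZero.exp (-((a * n : ℕ) : ℤ)) := by
  have hlead : Valued.v
      (toCompletion v (z 0 ^ n * Polynomial.aeval (z 1 / z 0) (formPoly f n))) =
      WithZero.exp (-((a * n : ℕ) : ℤ)) := by
    rw [valued_toCompletion, map_mul, map_pow,
      valuation_aeval_eq_one (w := ⟨z 1 / z 0, h⟩) hu (formPoly_ne_zero hn), mul_one, hza,
      ← WithZero.exp_nsmul]
    congr 1
    push_cast
    rw [nsmul_eq_mul]
    ring
  rw [← hlead]
  refine Valuation.map_eq_of_sub_lt _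
    ((valued_seriesEval_sub_le hz hza hn.ge).trans_lt ?_)
  rw [hlead, WithZero.exp_lt_exp, neg_lt_neg_iff, Nat.cast_lt]
  exact Nat.mul_lt_mul_of_pos_left n.lt_succ_self ha

/-- The value group being `ℤ`, the components of a terminal pair have value `1`: the values of the
elements of `k[[X₁, X₂]]` are multiples of their common value. -/
theorem valuation_eq_exp_neg_one_of_isTerminal [IsAlgClosed k] (hv : Function.Surjective v)
    {z : Fin 2 → Field₂ k} (hd : Dominates v z) (hz : IsTerminal v z) (i : Fin 2) :
    v (z i) = WithZero.exp (-1) := by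
  obtain ⟨a, ha, hza⟩ := exists_eq_exp_neg hz.ne_zero hz.lt_one
  have hza' : ∀ i, v (z i) = WithZero.exp (-(a : ℤ)) := by
    intro i
    fin_cases i
    · exact hza
    · exact hz.eq.trans hza
  have h : z 1 / z 0 ∈ v.valuationSubring := by
    rw [Valuation.mem_valuationSubring_iff, map_div₀, hz.eq, div_self hz.ne_zero]
  obtain ⟨ψ, hψ⟩ := hd.factors
  have hval : ∀ f : Ring₂ k, f ≠ 0 → ∃ n : ℕ,
      v (algebraMap (Ring₂ k) (Field₂ k) f) = WithZero.exp (-((a * n : ℕ) : ℤ)) := by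
    intro f hf
    have hf' := ne_zero_of_factors hψ hf
    refine ⟨((ψ f).weightedOrder fun _ => 1).toNat, ?_⟩
    rw [← valued_toCompletion, ← hψ]
    exact valued_seriesEval_eq hd.lt_one ha hza' h (transcendental_residue_of_isTerminal hz h)
      ((MvPowerSeries.ne_zero_iff_weightedOrder_finite (fun _ => 1)).mp hf').symm
  obtain ⟨x, hx⟩ := hv (WithZero.exp (-1))
  obtain ⟨f, g, hg, rfl⟩ := IsFractionRing.div_surjective (A := Ring₂ k) x
  have hf : f ≠ 0 := by
    rintro rfl
    rw [map_zero, zero_div, map_zero] at hx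
    exact WithZero.exp_ne_zero hx.symm
  obtain ⟨m, hm⟩ := hval f hf
  obtain ⟨n, hn⟩ := hval g (nonZeroDivisors.ne_zero hg)
  rw [map_div₀, hm, hn, ← WithZero.exp_sub, WithZero.exp_inj] at hx
  have : (a : ℤ) ∣ 1 := ⟨m - n, by push_cast at hx; linarith⟩
  have ha1 : a = 1 := by exact_mod_cast Int.eq_one_of_dvd_one (by positivity) this
  rw [hza', ha1]
  rfl

/-- The residue field is generated by the residue of `z₂ / z₁`: the residue of a fraction is the
quotient of the dehomogenized leading forms. -/
theorem adjoin_residue_eq_top {z : Fin 2 → Field₂ k} (hd : Dominates v z)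
    (hz1 : ∀ i, v (z i) = WithZero.exp (-1)) (h : z 1 / z 0 ∈ v.valuationSubring)
    (hu : Transcendental k (IsLocalRing.residue v.valuationSubring ⟨z 1 / z 0, h⟩)) :
    IntermediateField.adjoin k {IsLocalRing.residue v.valuationSubring ⟨z 1 / z 0, h⟩} = ⊤ := by
  obtain ⟨ψ, hψ⟩ := hd.factors
  set w : v.valuationSubring := ⟨z 1 / z 0, h⟩ with hw
  -- approximation of an element of `k[[X₁, X₂]]` by its leading form
  have happ : ∀ f : Ring₂ k, f ≠ 0 → ∃ (n : ℕ) (P : Polynomial k), P ≠ 0 ∧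
      v (algebraMap (Ring₂ k) (Field₂ k) f) = WithZero.exp (-(n : ℤ)) ∧
      v (algebraMap (Ring₂ k) (Field₂ k) f - z 0 ^ n * Polynomial.aeval (w : Field₂ k) P) ≤
        WithZero.exp (-((n + 1 : ℕ) : ℤ)) := by
    intro f hf
    have hf' := ne_zero_of_factors hψ hf
    have hn := ((MvPowerSeries.ne_zero_iff_weightedOrder_finite (fun _ => 1)).mp hf').symm
    refine ⟨((ψ f).weightedOrder fun _ => 1).toNat, formPoly (ψ f) _, formPoly_ne_zero hn, ?_, ?_⟩
    · rw [← valued_toCompletion, ← hψ]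
      simpa using valued_seriesEval_eq hd.lt_one one_pos (by simpa using hz1) h hu hn
    · rw [← valued_toCompletion, map_sub, ← hψ]
      simpa only [one_mul] using
        valued_seriesEval_sub_le hd.lt_one (a := 1) (by simpa using hz1) hn.ge
  rw [eq_top_iff]
  intro r _
  obtain ⟨⟨x, hx⟩, rfl⟩ := IsLocalRing.residue_surjective r
  rcases (show v x ≤ 1 from hx).lt_or_eq with hlt | heq
  · rw [(IsLocalRing.residue_eq_zero_iff _).mpr
      ((Valuation.mem_maximalIdeal_iff _ _ (a := ⟨x, hx⟩)).mpr hlt)]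
    exact zero_mem _
  obtain ⟨f, g, hg, rfl⟩ := IsFractionRing.div_surjective (A := Ring₂ k) x
  have hf : f ≠ 0 := by
    rintro rfl
    simp at heq
  obtain ⟨m, P, hP, hm, hfP⟩ := happ f hf
  obtain ⟨n, Q, hQ, hn, hgQ⟩ := happ g (nonZeroDivisors.ne_zero hg)
  have hmn : m = n := by
    rw [map_div₀, hm, hn, ← WithZero.exp_sub, WithZero.exp_eq_one] at heq
    omega
  subst hmn
  set F := algebraMap (Ring₂ k) (Field₂ k) f
  set G := algebraMap (Ring₂ k) (Field₂ k) g
  have hG0 : G ≠ 0 := by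
    rw [← map_ne_zero v, hn]
    simp
  have hvP := valuation_aeval_eq_one hu hP
  have hvQ := valuation_aeval_eq_one hu hQ
  have key : v (F / G * Polynomial.aeval (w : Field₂ k) Q -
      Polynomial.aeval (w : Field₂ k) P) < 1 := by
    have e : F / G * Polynomial.aeval (w : Field₂ k) Q - Polynomial.aeval (w : Field₂ k) P =
        ((F - z 0 ^ m * Polynomial.aeval (w : Field₂ k) P) * Polynomial.aeval (w : Field₂ k) Q -
          (G - z 0 ^ m * Polynomial.aeval (w : Field₂ k) Q) * Polynomial.aeval (w : Field₂ k) P) /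
          G := by
      field_simp
      ring
    rw [e, map_div₀, hn, div_lt_one₀ WithZero.exp_pos]
    refine ((v.map_sub _ _).trans
      (max_le (c := WithZero.exp (-((m + 1 : ℕ) : ℤ))) ?_ ?_)).trans_lt ?_
    · rwa [map_mul, hvQ, mul_one]
    · rwa [map_mul, hvP, mul_one]
    · rw [WithZero.exp_lt_exp]
      push_cast
      omega
  have hres : IsLocalRing.residue v.valuationSubring ⟨F / G, hx⟩ *
      Polynomial.aeval (IsLocalRing.residue v.valuationSubring w) Q =
      Polynomial.aeval (IsLocalRing.residue v.valuationSubring w) P := by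
    rw [← residue_aeval, ← residue_aeval, ← map_mul, residue_eq_residue_iff]
    simpa only [MulMemClass.coe_mul, coe_aeval_valuationSubring] using key
  have hQ0 : Polynomial.aeval (IsLocalRing.residue v.valuationSubring w) Q ≠ 0 :=
    fun h0 => hQ (transcendental_iff.mp hu Q h0)
  rw [eq_div_of_mul_eq hQ0 hres]
  have hmem : ∀ P : Polynomial k, Polynomial.aeval (IsLocalRing.residue v.valuationSubring w) P ∈
      IntermediateField.adjoin k {IsLocalRing.residue v.valuationSubring w} := fun P =>
    IntermediateField.algebra_adjoin_le_adjoin k _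
      (Polynomial.aeval_mem_adjoin_singleton k _)
  exact div_mem (hmem P) (hmem Q)

end Terminal

/-! ### The reduction theorem -/

theorem isEvaluation_seriesEval {k : Type*} [Field k] {v : Valuation (Field₂ k) ℤᵐ⁰} [IsCentered v]
    {z : Fin 2 → Field₂ k} (hz : ∀ i, v (z i) < 1) : IsEvaluation v z (seriesEval v hz) := by
  intro f
  have h := hasSum_evalHom (valued_constants_le_one v)
    (fun i => (valued_toCompletion v (z i)).trans_lt (hz i)) f
  refine h.congr_fun fun A => ?_
  simp [seriesTerm]

end PowerSeriesValuation

open PowerSeriesValuation in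
theorem mainTheorem3 {k : Type*} [Field k] [IsAlgClosed k]
    (v : Valuation (Field₂ k) ℤᵐ⁰) [IsCentered v] (hv : Function.Surjective v) :
    ∃ z : Fin 2 → Field₂ k,
      -- `v` is monomial and blowing-ups suffice, or coordinate changes are needed as well
      ((IsMonomial (fun f => v (algebraMap (Ring₂ k) (Field₂ k) f)) ∧
          Relation.ReflTransGen (BlowUp v) (coords k) z) ∨
        (¬ IsMonomial (fun f => v (algebraMap (Ring₂ k) (Field₂ k) f)) ∧
          Relation.ReflTransGen (Step v) (coords k) z)) ∧
      -- `z₁` and `z₂` have value `1`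
      (∀ i, v (z i) = WithZero.exp (-1)) ∧
      ∃ (ε : MvPowerSeries (Fin 2) k →+* v.Completion)
        (ψ : Ring₂ k →ₐ[k] MvPowerSeries (Fin 2) k),
        -- `k[[X₁, X₂]] ⊆ k[[z₁, z₂]]`, with `z₁, z₂` formally independent
        IsEvaluation v z ε ∧ Function.Injective ε ∧
        (∀ f, ε (ψ f) = toCompletion v (algebraMap (Ring₂ k) (Field₂ k) f)) ∧
        -- the restriction of the completed valuation to `k[[z₁, z₂]]` is monomial
        IsMonomialWith (fun f => completedValuation v (ε f)) (fun _ => 1) ∧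
        -- the residue field is `k(u)`, with `u` the residue of `z₂ / z₁`
        ∃ (h : z 1 / z 0 ∈ v.valuationSubring) (u : Residue v),
          u = IsLocalRing.residue v.valuationSubring ⟨z 1 / z 0, h⟩ ∧
          Transcendental k u ∧ IntermediateField.adjoin k {u} = ⊤ ∧
          -- the valuation is the pullback of the `t`-order under `z₁ ↦ t`, `z₂ ↦ u t`
          Function.Injective (lineSubst k u) ∧
          (∀ f, completedValuation v (ε f) = ofOrder (lineSubst k u f).order) ∧
          (∀ f, v (algebraMap (Ring₂ k) (Field₂ k) f) =
            ofOrder (lineSubst k u (ψ f)).order) := by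

  obtain ⟨z, hproc, hz⟩ : ∃ z : Fin 2 → Field₂ k,
      ((IsMonomial (fun f => v (algebraMap (Ring₂ k) (Field₂ k) f)) ∧
          Relation.ReflTransGen (BlowUp v) (coords k) z) ∨
        (¬ IsMonomial (fun f => v (algebraMap (Ring₂ k) (Field₂ k) f)) ∧
          Relation.ReflTransGen (Step v) (coords k) z)) ∧ IsTerminal v z := by
    by_cases hmon : IsMonomial (fun f => v (algebraMap (Ring₂ k) (Field₂ k) f))
    · obtain ⟨z, hr, hz⟩ := exists_isTerminal_of_isMonomial hmon
      exact ⟨z, .inl ⟨hmon, hr⟩, hz⟩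
    · obtain ⟨z, hr, hz⟩ := exists_isTerminal v
      exact ⟨z, .inr ⟨hmon, hr⟩, hz⟩
  have hd : Dominates v z := dominates_of_reflTransGen
    (hproc.elim (fun h => reflTransGen_step_of_blowUp h.2) fun h => h.2)
  have hz1 := valuation_eq_exp_neg_one_of_isTerminal hv hd hz
  have h : z 1 / z 0 ∈ v.valuationSubring := by
    rw [Valuation.mem_valuationSubring_iff, map_div₀, hz.eq, div_self hz.ne_zero]
  have hu := transcendental_residue_of_isTerminal hz h
  have hval : ∀ f, completedValuation v (seriesEval v hd.lt_one f) =
      ofOrder (f.weightedOrder fun _ => 1) := by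
    intro f
    rcases eq_or_ne f 0 with rfl | hf
    · simp [ofOrder]
    · have hn := (MvPowerSeries.ne_zero_iff_weightedOrder_finite (fun _ => 1)).mp hf
      rw [← hn, ofOrder_natCast]
      have hf' := valued_seriesEval_eq hd.lt_one one_pos (by simpa using hz1) h hu hn.symm
      rw [one_mul] at hf'
      exact hf'
  have hinj : Function.Injective (seriesEval v hd.lt_one) := by
    rw [injective_iff_map_eq_zero]
    intro f hf
    by_contra hf0
    have hn := (MvPowerSeries.ne_zero_iff_weightedOrder_finite (fun _ => 1)).mp hf0
    have := hval f
    rw [hf, map_zero, ← hn, ofOrder_natCast] at this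
    exact WithZero.exp_ne_zero this.symm
  obtain ⟨ψ, hψ⟩ := hd.factors
  refine ⟨z, hproc, hz1, seriesEval v hd.lt_one, ψ, isEvaluation_seriesEval hd.lt_one, hinj, hψ,
    ⟨fun _ => one_pos, ?_, hval⟩, h, _, rfl, hu, adjoin_residue_eq_top hd hz1 h hu,
    lineSubst_injective hu, fun f => ?_, fun f => ?_⟩
  · simp
  · rw [hval, order_lineSubst hu]
  · rw [order_lineSubst hu, ← hval, hψ]
    exact (valued_toCompletion v _).symm
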